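/- \textbf{Theorem (Generalization of the Cole-Hopf transform).} \textbf{(A) Logarithmic representation.} Let $L>0$, let $X$ be a complex Banach space and $Y\subset X$ a dense subspace that is a Banach space for a stronger norm. Let $\{U(x,\xi)\}_{0\le x,\xi\le L}\subset B(X)$ be an invertible evolution family: $U(x,\eta)U(\eta,\xi)=U(x,\xi)$ and $U(\xi,\xi)=I$ for all $x,\eta,\xi\in[0,L]$ (hence $U(x,\xi)^{-1}=U(\xi,x)$). Assume that $U(x,\xi)$ maps $Y$ into $Y$, that $x\mapsto U(x,\xi)$ is strongly continuous on $X$ and on $Y$, and that $\|U(x,\xi)\|_{B(X)},\|U(x,\xi)\|_{B(Y)}\le Me^{\beta x}$ for some constants $M,\beta$. Let the family be generated by linear operators $A(x):Y\to X$, that is, $A(x)u=\mathop{\mathrm{w\text{-}lim}}_{h\to0}h^{-1}(U(x+h,x)-I)u$ weakly in $X$ for $u\in Y$, $x\in[0,L]$ (with $x+h\in[0,L]$), and assume $A(x)U(x,\xi)u=U(x,\xi)A(x)u$ for $u\in Y$. Let $\kappa\in\mathbb C$ and $r>0$ be such that the closed disc $\{|z-\kappa|\le r\}$ does not meet $(-\infty,0]$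 and $\sup_{x,\xi}\max(\|U(x,\xi)\|_{B(X)},\|U(x,\xi)\|_{B(Y)})<r$. Such $(\kappa,r)$ exist, and necessarily $\kappa\ne0$. The spectrum of $U(x,\xi)+\kappa I$ lies inside the circle $\Gamma=\{|z-\kappa|=r\}$; put $$a(x,\xi)=\mathrm{Log}(U(x,\xi)+\kappa I)=\frac1{2\pi i}\int_\Gamma \mathrm{Log}\,z\,(zI-U(x,\xi)-\kappa I)^{-1}dz\in B(X).$$ Then $e^{a(x,\xi)}=U(x,\xi)+\kappa I$ and, for all $x,\xi\in[0,L]$ and $u\in Y$, the weak derivative $\partial_x a(x,\xi)u$ exists, is unique, and $$A(x)U(x,\xi)u=e^{a(x,\xi)}\,[\partial_x\mathrm{Log}(U(x,\xi)+\kappa I)]u .$$ Moreover $I-\kappa e^{-a(x,\xi)}$ is invertible in $B(X)$, and the normalized form holds: $$A(x)u=(I-\kappa e^{-a(x,\xi)})^{-1}[\partial_x\mathrm{Log}(U(x,\xi)+\kappa I)]u=(I+\kappa U(\xi,x))[\partial_x\mathrm{Log}(U(x,\xi)+\kappa I)]u .$$ \textbf{(B) Relation to the Cole-Hopf transform} $\psi=-2\mu^{-1/2}\partial_x\log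 w=-2\mu^{-1/2}(\partial_xw)w^{-1}$, $\mu>0$. In the situation of (A), for every continuous linear functional $\varphi$ on $X$ and all $x,\xi\in[0,L]$, $u\in Y$ with $w(x)\neq0$, where $w(z)=\varphi(U(z,\xi)u)$, the function $w$ is differentiable at $x$ within $[0,L]$ and $$\psi(x)=-2\mu^{-1/2}\,\varphi\big(e^{a(x,\xi)}[\partial_x\mathrm{Log}(U(x,\xi)+\kappa I)]u\big)\,w(x)^{-1}.$$ If $B$ is a commutative unital complex Banach algebra and $w:[0,L]\to B$ is differentiable with invertible values, then multiplication by $w(x)w(\xi)^{-1}$ defines on $X=Y=B$ a family $U(x,\xi)$ that satisfies all assumptions of (A), with $A(x)$ the multiplication by $w'(x)w(x)^{-1}$ and $U(x,\xi)w(\xi)=w(x)$, and for $v\in B$ and every $(\kappa,r)$ as in (A) $$\psi(x)\,v=-2\mu^{-1/2}\,(I-\kappa e^{-a(x,\xi)})^{-1}[\partial_x\mathrm{Log}(U(x,\xi)+\kappa I)]v,\qquad \psi=-2\mu^{-1/2}w'w^{-1}.$$ \textbf{(C) Evolution of the heat equation in the $x$-direction.} Let $\mu>0$, and let $\partial_t$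 be the weak derivative in $L^2(\mathbb R)$ with domain $H^1(\mathbb R)=\{f\in L^2: f'\in L^2\}$. Then $\mu^{1/2}\partial_t$ is the infinitesimal generator of the isometric $C_0$-group $(V(h)f)(t)=f(t+\mu^{1/2}h)$ on $L^2(\mathbb R)$. For $0<\alpha<1$ let $(\mu^{1/2}\partial_t)^\alpha$ be the Fourier multiplier with symbol $(i\mu^{1/2}\omega)^\alpha$ (principal branch, $\omega$ the angular frequency) and maximal domain in $L^2(\mathbb R)$; then $-(\mu^{1/2}\partial_t)^\alpha$ is the infinitesimal generator of a $C_0$-semigroup of contractions on $L^2(\mathbb R)$. For $\alpha=1/2$ the operator $R=(\mu^{1/2}\partial_t)^{1/2}$ satisfies $R^2=\mu^{1/2}\partial_t$, domains included, and the $C_0$-semigroup $W$ generated by its negative $-R$ evolves the heat equation in the $x$-direction: for every $f\in L^2(\mathbb R)$, $w(x)=W(x)f$ is twice differentiable in $L^2(\mathbb R)$ for $x>0$, with $w(x)$ in the domains of $R$ and $\mu^{1/2}\partial_t$, $$\partial_xw=-Rw,\qquad \partial_x^2w=\mu^{1/2}\partial_tw ;$$ likewise $w(x)=W(-x)f$ satisfies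 $\partial_xw=+Rw$ and $\partial_x^2w=\mu^{1/2}\partial_tw$ for $x<0$. -/

import Mathlib

open MeasureTheory Set Filter Topology
open scoped FourierTransform ContDiff

noncomputable section

namespace ColeHopf

section Abstract

variable {X : Type*} [NormedAddCommGroup X] [NormedSpace ℂ X]
variable {Y : Type*} [NormedAddCommGroup Y] [NormedSpace ℂ Y]

/-- `v` is the weak derivative of `f` at `x` within `s`: for every continuous linear functional
`φ`, the scalar function `φ ∘ f` has derivative `φ v` at `x` within `s`. -/
def HasWeakDerivWithinAt (f : ℝ → X) (v : X) (s : Set ℝ) (x : ℝ) : Prop :=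
  ∀ φ : X →L[ℂ] ℂ, HasDerivWithinAt (fun z => φ (f z)) (φ v) s x

/-- `U` is an invertible evolution family on the Banach space `X` with parameters in `[0, L]`,
compatible with the dense Banach subspace `J : Y → X`, on which it restricts to `UY`; and
`A x : Y → X` is its pre-infinitesimal generator,
`A x y = w-lim_{h → 0} h⁻¹ (U (x + h) x - I) y`.
Invertibility is contained in `comp` and `refl`: `U x ξ * U ξ x = U x x = 1`. -/
structure IsEvolutionFamily (L : ℝ) (J : Y →L[ℂ] X) (U : ℝ → ℝ → X →L[ℂ] X)
    (UY : ℝ → ℝ → Y →L[ℂ] Y) (A : ℝ → Y →ₗ[ℂ] X) : Prop where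
  injective : Function.Injective J
  denseRange : DenseRange J
  comp : ∀ t ∈ Icc 0 L, ∀ r ∈ Icc 0 L, ∀ s ∈ Icc 0 L, U t r * U r s = U t s
  refl : ∀ s ∈ Icc 0 L, U s s = 1
  restrict : ∀ t ∈ Icc 0 L, ∀ s ∈ Icc 0 L, ∀ y, J (UY t s y) = U t s (J y)
  continuousOn : ∀ s ∈ Icc 0 L, ∀ v, ContinuousOn (fun t => U t s v) (Icc 0 L)
  continuousOn_sub : ∀ s ∈ Icc 0 L, ∀ y, ContinuousOn (fun t => UY t s y) (Icc 0 L)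
  bounded : ∃ M β : ℝ, ∀ t ∈ Icc 0 L, ∀ s ∈ Icc 0 L,
    ‖U t s‖ ≤ M * Real.exp (β * t) ∧ ‖UY t s‖ ≤ M * Real.exp (β * t)
  generator : ∀ x ∈ Icc 0 L, ∀ y,
    HasWeakDerivWithinAt (fun z => U z x (J y)) (A x y) (Icc 0 L) x

/-- The generator commutes with the evolution family: `A(x) U(x, ξ) = U(x, ξ) A(x)` on `Y`. -/
def Commutes (L : ℝ) (U : ℝ → ℝ → X →L[ℂ] X) (UY : ℝ → ℝ → Y →L[ℂ] Y)
    (A : ℝ → Y →ₗ[ℂ] X) : Prop :=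
  ∀ x ∈ Icc 0 L, ∀ ξ ∈ Icc 0 L, ∀ y, A x (UY x ξ y) = U x ξ (A x y)

/-- The shift `κ` and the circle with center `κ` and radius `r` are suited to define
`Log (U x ξ + κ I)`, independently of `x` and `ξ`: the closed disc avoids the cut `(-∞, 0]` of
the principal logarithm, and `r` exceeds a common bound of the operators `U x ξ` on `X` and of
their restrictions to `Y`. -/
def IsLogContour (L : ℝ) (U : ℝ → ℝ → X →L[ℂ] X) (UY : ℝ → ℝ → Y →L[ℂ] Y) (κ : ℂ) (r : ℝ) :
    Prop :=
  Metric.closedBall κ r ⊆ Complex.slitPlane ∧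
    ∃ M < r, ∀ x ∈ Icc 0 L, ∀ ξ ∈ Icc 0 L, ‖U x ξ‖ ≤ M ∧ ‖UY x ξ‖ ≤ M

/-- The principal logarithm of a bounded operator as a Dunford-Riesz integral,
`Log T = (2πi)⁻¹ ∮ (Log z) (z I - T)⁻¹ dz`, over the circle with center `c` and radius `r`. -/
def dunfordLog (c : ℂ) (r : ℝ) (T : X →L[ℂ] X) : X →L[ℂ] X :=
  (2 * Real.pi * Complex.I : ℂ)⁻¹ • ∮ z in C(c, r), Complex.log z • resolvent T z

/-- The operator `a(x, ξ) = Log (U(x, ξ) + κ I)`. -/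
def logOp (U : ℝ → ℝ → X →L[ℂ] X) (κ : ℂ) (r : ℝ) (x ξ : ℝ) : X →L[ℂ] X :=
  dunfordLog κ r (U x ξ + κ • (1 : X →L[ℂ] X))

/-- The classical Cole-Hopf transform `-2 μ^{-1/2} ∂_x log w = -2 μ^{-1/2} (∂_x w) w⁻¹` of a
scalar function on `[0, L]`. -/
def coleHopf (μ L : ℝ) (w : ℝ → ℂ) (x : ℝ) : ℂ :=
  ((-2 * (√μ)⁻¹ : ℝ) : ℂ) * (derivWithin w (Icc 0 L) x * (w x)⁻¹)

end Abstract

section Semigroup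

variable {E : Type*} [NormedAddCommGroup E] [NormedSpace ℂ E]

/-- `S` is a strongly continuous semigroup on `E` (only nonnegative parameters matter). -/
structure IsC0Semigroup (S : ℝ → E →L[ℂ] E) : Prop where
  zero : S 0 = 1
  add : ∀ s t : ℝ, 0 ≤ s → 0 ≤ t → S (s + t) = S s * S t
  continuousOn : ∀ f, ContinuousOn (fun t => S t f) (Ici 0)

/-- The unbounded operator `A` (with exactly its domain) is the infinitesimal generator of `S`. -/
def IsGenerator (A : E →ₗ.[ℂ] E) (S : ℝ → E →L[ℂ] E) : Prop :=
  ∀ f g : E, (f, g) ∈ A.graph ↔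
    Tendsto (fun h : ℝ => ((h⁻¹ : ℝ) : ℂ) • (S h f - f)) (𝓝[>] 0) (𝓝 g)

end Semigroup

section L2

/-- The Hilbert space `L²(-∞, ∞)` of complex-valued functions. -/
abbrev L2 : Type := Lp ℂ 2 (volume : Measure ℝ)

theorem integrable_test_smul {φ : ℝ → ℝ} (hφ : Continuous φ) (hs : HasCompactSupport φ) (f : L2) :
    Integrable (fun t => φ t • f t) :=
  ((Lp.memLp f).locallyIntegrable (by norm_num)).integrable_smul_left_of_hasCompactSupport hφ hs

/-- The graph of the weak derivative in `L²(-∞, ∞)`: pairs `(f, g)` with `∫ φ' f = -∫ φ g` for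
every smooth compactly supported `φ`. -/
def weakDerivGraph : Submodule ℂ (L2 × L2) where
  carrier := {p | ∀ φ : ℝ → ℝ, ContDiff ℝ ∞ φ → HasCompactSupport φ →
    ∫ t, deriv φ t • p.1 t = -∫ t, φ t • p.2 t}
  zero_mem' := by
    intro φ _ _
    have h : ∀ ψ : ℝ → ℝ, ∫ t, ψ t • (0 : L2) t = 0 := by
      intro ψ
      refine integral_eq_zero_of_ae ?_
      filter_upwards [Lp.coeFn_zero ℂ 2 (volume : Measure ℝ)] with t ht
      simp
    simp only [Prod.fst_zero, Prod.snd_zero, h, neg_zero]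
  add_mem' := by
    intro p q hp hq φ hφ hs
    have hadd : ∀ ψ : ℝ → ℝ, Continuous ψ → HasCompactSupport ψ → ∀ f g : L2,
        ∫ t, ψ t • (f + g) t = (∫ t, ψ t • f t) + ∫ t, ψ t • g t := by
      intro ψ h1 h2 f g
      rw [← integral_add (integrable_test_smul h1 h2 f) (integrable_test_smul h1 h2 g)]
      refine integral_congr_ae ?_
      filter_upwards [Lp.coeFn_add f g] with t ht
      rw [ht, Pi.add_apply, smul_add]
    have h1 := hp φ hφ hs
    have h2 := hq φ hφ hs
    simp only [Prod.fst_add, Prod.snd_add]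
    rw [hadd _ (hφ.continuous_deriv (by simp)) hs.deriv, hadd _ hφ.continuous hs, h1, h2]
    ring
  smul_mem' := by
    intro c p hp φ hφ hs
    have hsm : ∀ ψ : ℝ → ℝ, ∀ f : L2, ∫ t, ψ t • (c • f) t = c * ∫ t, ψ t • f t := by
      intro ψ f
      rw [← integral_const_mul]
      refine integral_congr_ae ?_
      filter_upwards [Lp.coeFn_smul c f] with t ht
      simp [ht, mul_left_comm]
    have h1 := hp φ hφ hs
    simp only [Prod.smul_fst, Prod.smul_snd]
    rw [hsm, hsm, h1]
    ring

theorem weakDerivGraph_functional (p : L2 × L2) (hp : p ∈ weakDerivGraph) (h : p.1 = 0) :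
    p.2 = 0 := by
  have h0 : ∀ φ : ℝ → ℝ, ContDiff ℝ ∞ φ → HasCompactSupport φ → ∫ t, φ t • p.2 t = 0 := by
    intro φ hφ hs
    have h1 := hp φ hφ hs
    have h2 : ∫ t, deriv φ t • p.1 t = 0 := by
      refine integral_eq_zero_of_ae ?_
      rw [h]
      filter_upwards [Lp.coeFn_zero ℂ 2 (volume : Measure ℝ)] with t ht
      simp
    rw [h2] at h1
    exact neg_eq_zero.mp h1.symm
  have h3 := ae_eq_zero_of_integral_contDiff_smul_eq_zero
    ((Lp.memLp p.2).locallyIntegrable (by norm_num)) h0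
  exact (Lp.eq_zero_iff_ae_eq_zero).2 h3

/-- The operator `∂_t` in `L²(-∞, ∞)`, with domain
`H¹(-∞, ∞) = {f ∈ L² | the weak derivative of f is in L²}`. -/
def ddt : L2 →ₗ.[ℂ] L2 := weakDerivGraph.toLinearPMap

theorem ddt_graph : ddt.graph = weakDerivGraph :=
  Submodule.toLinearPMap_graph_eq _ weakDerivGraph_functional

/-- The graph of the Fourier multiplier with symbol `m` and maximal domain. -/
def multiplierGraph (m : ℝ → ℂ) : Submodule ℂ (L2 × L2) where
  carrier := {p | (𝓕 p.2 : L2) =ᵐ[volume] fun w => m w * (𝓕 p.1 : L2) w}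
  zero_mem' := by
    have h0 : (𝓕 (0 : L2) : L2) = 0 := (Lp.fourierTransformₗᵢ ℝ ℂ).map_zero
    simp only [mem_ofPred_eq, Prod.fst_zero, Prod.snd_zero, h0]
    filter_upwards [Lp.coeFn_zero ℂ 2 (volume : Measure ℝ)] with t ht
    simp
  add_mem' := by
    intro p q hp hq
    have hadd : ∀ f g : L2, (𝓕 (f + g) : L2) = 𝓕 f + 𝓕 g :=
      (Lp.fourierTransformₗᵢ ℝ ℂ).map_add
    simp only [mem_ofPred_eq, Prod.fst_add, Prod.snd_add, hadd] at hp hq ⊢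
    filter_upwards [hp, hq, Lp.coeFn_add (𝓕 p.1 : L2) (𝓕 q.1),
      Lp.coeFn_add (𝓕 p.2 : L2) (𝓕 q.2)] with t h1 h2 h3 h4
    rw [h3, h4, Pi.add_apply, Pi.add_apply, h1, h2, mul_add]
  smul_mem' := by
    intro c p hp
    have hsm : ∀ f : L2, (𝓕 (c • f) : L2) = c • 𝓕 f :=
      (Lp.fourierTransformₗᵢ ℝ ℂ).map_smul c
    simp only [mem_ofPred_eq, Prod.smul_fst, Prod.smul_snd, hsm] at hp ⊢
    filter_upwards [hp, Lp.coeFn_smul c (𝓕 p.1 : L2), Lp.coeFn_smul c (𝓕 p.2 : L2)]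
      with t h1 h2 h3
    rw [h2, h3, Pi.smul_apply, Pi.smul_apply, h1, smul_eq_mul, smul_eq_mul, mul_left_comm]

theorem multiplierGraph_functional (m : ℝ → ℂ) (p : L2 × L2) (hp : p ∈ multiplierGraph m)
    (h : p.1 = 0) : p.2 = 0 := by
  have h0 : (𝓕 (0 : L2) : L2) = 0 := (Lp.fourierTransformₗᵢ ℝ ℂ).map_zero
  have hp' : (𝓕 p.2 : L2) =ᵐ[volume] fun w => m w * (𝓕 p.1 : L2) w := hp
  rw [h, h0] at hp'
  have h1 : (𝓕 p.2 : L2) = 0 := by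
    refine (Lp.eq_zero_iff_ae_eq_zero).2 ?_
    filter_upwards [hp', Lp.coeFn_zero ℂ 2 (volume : Measure ℝ)] with t h1 h2
    simp [h1]
  exact (Lp.fourierTransformₗᵢ ℝ ℂ).map_eq_zero_iff.1 h1

/-- The fractional power `(c ∂_t)^α` in `L²(-∞, ∞)`: the Fourier multiplier with symbol
`(2π i c w)^α` (principal branch) and maximal domain. -/
def fracPow (c α : ℝ) : L2 →ₗ.[ℂ] L2 :=
  (multiplierGraph fun w => (2 * Real.pi * Complex.I * c * w : ℂ) ^ (α : ℂ)).toLinearPMap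

theorem fracPow_graph (c α : ℝ) : (fracPow c α).graph =
    multiplierGraph fun w => (2 * Real.pi * Complex.I * c * w : ℂ) ^ (α : ℂ) :=
  Submodule.toLinearPMap_graph_eq _ (multiplierGraph_functional _)

end L2

end ColeHopf

end

/-! (A) Put S = U(z,ξ), T = U(x,ξ). Since the closed disc avoids 0, ‖T‖ < r < |κ|, and the Dunford
integral is the Taylor series of Log at κ, evaluated at T. If S and T commute, termwise
factorization gives Log(S+κ) − Log(T+κ) = (S − T)Q(S,T) with Q(S,T) = Σ c_n Σ_k S^k T^(n−k). As S −
T = (U(z,x) − I)T, the difference quotient of a(·,ξ)y is that of U(·,x) at the moving vector T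
Q(S,T)y, which converges in Y. Banach–Steinhaus (`tendsto_slope`) turns this into the weak limit g =
A(x)Tq, where q = Q(T,T)y = (T+κ)⁻¹y in Y. Because A(x) commutes with T, (T+κ)g = A(x)Ty and g +
κT⁻¹g = A(x)(Tq + κq) = A(x)y. The exponential of the series is T + κ, because exp(−ℓ(s))(1+sT) is
constant for the Mercator series ℓ.

Commutativity of the family is not assumed: r ↦ U(t,r)U(a,b)U(r,t)y has zero weak derivative once
A(r) commutes with U(a,b), hence is constant (`commute`).

(B) The scalar formula applies a functional to the derivative of the orbit. In the algebra case A(x)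
is multiplication by w'/w, so the normalized form is the classical transform.

(C) The Fourier transform turns every operator into multiplication. A measurable symbol m with Re m
≤ 0 yields the contraction semigroup e^{tm}, whose generator is the maximal multiplier m: dominated
convergence gives one inclusion, an a.e. convergent subsequence the other. The symbol (iω)^α lies in
a sector of half-angle απ/2 < π/2; for α = 1/2 this gives decay e^{−δx|m|}, so orbits are smooth for
x > 0, and m² is the symbol of μ^{1/2}∂_t. That ∂_t on H¹ is the multiplier 2πiw follows since 1 −
∂_t is injective on H¹ and already surjective on the multiplier domain. -/

namespace ColeHopf

/-! ### Evolution families: weak generators along moving vectors, commutativity -/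

section Abstract

variable {X : Type*} [NormedAddCommGroup X] [NormedSpace ℂ X]
variable {Y : Type*} [NormedAddCommGroup Y] [NormedSpace ℂ Y]

/-- Pointwise convergence of functionals on a Banach space upgrades to joint convergence. -/
theorem tendsto_clm_apply_of_pointwise [CompleteSpace Y] {ι : Type*} {l : Filter ι}
    [l.IsCountablyGenerated] {f : ι → Y →L[ℂ] ℂ} {f₀ : Y → ℂ}
    (hf : ∀ y, Tendsto (fun i => f i y) l (𝓝 (f₀ y))) {w : ι → Y} {w₀ : Y}
    (hw : Tendsto w l (𝓝 w₀)) : Tendsto (fun i => f i (w i)) l (𝓝 (f₀ w₀)) := by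
  -- A convergent family along a general filter need not be bounded; a convergent sequence is, so
  -- Banach–Steinhaus is applied along sequences.
  refine tendsto_of_seq_tendsto fun u hu => ?_
  obtain ⟨C, hC⟩ := banach_steinhaus (g := fun n => f (u n)) fun y => by
    obtain ⟨C, hC⟩ := (((hf y).comp hu).norm).bddAbove_range
    exact ⟨C, fun i => hC ⟨i, rfl⟩⟩
  have h1 : Tendsto (fun n => f (u n) (w (u n) - w₀)) atTop (𝓝 0) := by
    have h2 : Tendsto (fun n => C * ‖w (u n) - w₀‖) atTop (𝓝 0) := by
      have := ((hw.comp hu).sub_const w₀).norm.const_mul C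
      simpa using this
    refine squeeze_zero_norm (fun n => ?_) h2
    exact ((f (u n)).le_opNorm _).trans (by gcongr; exact hC n)
  have h3 := ((hf w₀).comp hu).add h1
  simp only [add_zero] at h3
  refine h3.congr fun n => ?_
  simp

/-- Strong convergence of uniformly bounded operators upgrades to joint convergence. -/
theorem tendsto_clm_apply_of_bounded {ι : Type*} {l : Filter ι} {T : ι → Y →L[ℂ] X}
    {T₀ : Y →L[ℂ] X} {C : ℝ} (hC : ∀ᶠ i in l, ‖T i‖ ≤ C) {w : ι → Y} {w₀ : Y}
    (hT : Tendsto (fun i => T i w₀) l (𝓝 (T₀ w₀)))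
    (hw : Tendsto w l (𝓝 w₀)) : Tendsto (fun i => T i (w i)) l (𝓝 (T₀ w₀)) := by
  have h1 : Tendsto (fun i => T i (w i - w₀)) l (𝓝 0) := by
    have h2 : Tendsto (fun i => C * ‖w i - w₀‖) l (𝓝 0) := by
      simpa using (hw.sub_const w₀).norm.const_mul C
    refine squeeze_zero_norm' ?_ h2
    filter_upwards [hC] with i hi
    exact ((T i).le_opNorm _).trans (by gcongr)
  have h3 := hT.add h1
  simp only [add_zero] at h3
  refine h3.congr fun n => ?_
  simp

namespace IsEvolutionFamily

variable {L : ℝ} {J : Y →L[ℂ] X} {U : ℝ → ℝ → X →L[ℂ] X} {UY : ℝ → ℝ → Y →L[ℂ] Y}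
  {A : ℝ → Y →ₗ[ℂ] X}

theorem comp_apply (h : IsEvolutionFamily L J U UY A) {t r s : ℝ} (ht : t ∈ Icc 0 L)
    (hr : r ∈ Icc 0 L) (hs : s ∈ Icc 0 L) (v : X) : U t r (U r s v) = U t s v := by
  rw [← h.comp t ht r hr s hs]; rfl

theorem refl_apply (h : IsEvolutionFamily L J U UY A) {s : ℝ} (hs : s ∈ Icc 0 L) (v : X) :
    U s s v = v := by
  rw [h.refl s hs]; rfl

theorem comp_sub_apply (h : IsEvolutionFamily L J U UY A) {t r s : ℝ} (ht : t ∈ Icc 0 L)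
    (hr : r ∈ Icc 0 L) (hs : s ∈ Icc 0 L) (v : Y) : UY t r (UY r s v) = UY t s v := by
  apply h.injective
  rw [h.restrict t ht r hr, h.restrict r hr s hs, h.restrict t ht s hs, h.comp_apply ht hr hs]

theorem refl_sub_apply (h : IsEvolutionFamily L J U UY A) {s : ℝ} (hs : s ∈ Icc 0 L) (v : Y) :
    UY s s v = v := by
  apply h.injective
  rw [h.restrict s hs s hs, h.refl_apply hs]

theorem exists_bound (h : IsEvolutionFamily L J U UY A) :
    ∃ C, 0 ≤ C ∧ ∀ t ∈ Icc 0 L, ∀ s ∈ Icc 0 L, ‖U t s‖ ≤ C ∧ ‖UY t s‖ ≤ C := by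
  obtain ⟨M, β, hM⟩ := h.bounded
  refine ⟨|M| * Real.exp (|β| * L), by positivity, fun t ht s hs => ?_⟩
  have h1 : M * Real.exp (β * t) ≤ |M| * Real.exp (|β| * L) := by
    have h3 : β * t ≤ |β| * L :=
      (mul_le_mul_of_nonneg_right (le_abs_self β) ht.1).trans
        (mul_le_mul_of_nonneg_left ht.2 (abs_nonneg β))
    gcongr
    exact le_abs_self M
  exact ⟨(hM t ht s hs).1.trans h1, (hM t ht s hs).2.trans h1⟩

/-- The scalar difference quotients are functionals on the Banach space Y that converge pointwise,
so the vector may move with z, provided it converges in Y. This is how the weak generator enters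
every product rule below. -/
theorem tendsto_slope [CompleteSpace Y] (h : IsEvolutionFamily L J U UY A) {x : ℝ}
    (hx : x ∈ Icc 0 L) (ψ : X →L[ℂ] ℂ) {w : ℝ → Y} {w₀ : Y}
    (hw : Tendsto w (𝓝[Icc 0 L \ {x}] x) (𝓝 w₀)) :
    Tendsto (fun z => (z - x)⁻¹ • ψ (U z x (J (w z)) - J (w z))) (𝓝[Icc 0 L \ {x}] x)
      (𝓝 (ψ (A x w₀))) := by
  have := tendsto_clm_apply_of_pointwise
    (f := fun z => ((z - x)⁻¹ : ℝ) • (ψ ∘L (U z x - 1) ∘L J)) (f₀ := fun y => ψ (A x y))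
    (fun y => by
      have h1 := (hasDerivWithinAt_iff_tendsto_slope.1 (h.generator x hx y ψ))
      refine h1.congr fun z => ?_
      simp [slope_def_module, h.refl_apply hx]) hw
  refine this.congr fun z => ?_
  simp

/-- Factor U(a,b) = U(a,s)U(s,b): the hypothesis covers the second factor, and the first is the
inverse of U(s,a), which it also covers. -/
theorem generator_comm (h : IsEvolutionFamily L J U UY A) (hc : Commutes L U UY A) {s a b : ℝ}
    (hs : s ∈ Icc 0 L) (ha : a ∈ Icc 0 L) (hb : b ∈ Icc 0 L) (y : Y) :
    A s (UY a b y) = U a b (A s y) := by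
  have h1 : ∀ v, A s (UY a s v) = U a s (A s v) := fun v => by
    have h2 : A s v = U s a (A s (UY a s v)) := by
      rw [← hc s hs a ha, h.comp_sub_apply hs ha hs, h.refl_sub_apply hs]
    rw [h2, h.comp_apply ha hs ha, h.refl_apply ha]
  rw [← h.comp_sub_apply ha hs hb, h1, hc s hs b hb, h.comp_apply ha hs hb]

/-- Continuity in the second variable comes from that in the first: U(s,z)(w₀ − U(z,s)w₀) = U(s,z)w₀
− w₀, with U(s,z) uniformly bounded. -/
theorem tendsto_sub_right (h : IsEvolutionFamily L J U UY A) {s : ℝ} (hs : s ∈ Icc 0 L)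
    {w : ℝ → Y} {w₀ : Y} {l : Filter ℝ} (hl : l ≤ 𝓝[Icc 0 L] s) (hw : Tendsto w l (𝓝 w₀)) :
    Tendsto (fun z => UY s z (w z)) l (𝓝 w₀) := by
  obtain ⟨C, -, hC⟩ := h.exists_bound
  have hmem : ∀ᶠ z in l, z ∈ Icc 0 L := hl self_mem_nhdsWithin
  have h1 := tendsto_clm_apply_of_bounded (T := fun z => UY s z) (T₀ := 1) (C := C)
    (hmem.mono fun z hz => (hC s hs z hz).2) (w₀ := w₀) (w := w) (l := l) ?_ hw
  · simpa using h1
  · have h2 : Tendsto (fun z => UY z s w₀) l (𝓝 w₀) := by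
      have : Tendsto _ l (𝓝 (UY s s w₀)) := (h.continuousOn_sub s hs w₀ s hs).mono_left hl
      rwa [h.refl_sub_apply hs] at this
    have h3 : Tendsto (fun z => UY s z (w₀ - UY z s w₀)) l (𝓝 0) := by
      have h4 : Tendsto (fun z => C * ‖w₀ - UY z s w₀‖) l (𝓝 0) := by
        simpa using (h2.const_sub w₀).norm.const_mul C
      refine squeeze_zero_norm' ?_ h4
      filter_upwards [hmem] with z hz
      exact ((UY s z).le_opNorm _).trans (by gcongr; exact (hC s hs z hz).2)
    have h5 := h3.add_const w₀
    simp only [zero_add] at h5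
    refine h5.congr' ?_
    filter_upwards [hmem] with z hz
    rw [map_sub, h.comp_sub_apply hs hz hs, h.refl_sub_apply hs]
    simp

/-- If the generator commutes with the family, all members of the family commute. -/
theorem commute [CompleteSpace Y] (h : IsEvolutionFamily L J U UY A) (hc : Commutes L U UY A)
    {a b s t : ℝ} (ha : a ∈ Icc 0 L) (hb : b ∈ Icc 0 L) (hs : s ∈ Icc 0 L) (ht : t ∈ Icc 0 L) :
    Commute (U a b) (U s t) := by
  have key : ∀ y, U t s (U a b (U s t (J y))) = U a b (J y) := by
    intro y
    refine (SeparatingDual.eq_iff_forall_dual_eq (R := ℂ)).2 fun ψ => ?_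
    have hd : ∀ r ∈ Icc 0 L, HasDerivWithinAt (fun r => ψ (U t r (U a b (U r t (J y))))) 0
        (Icc 0 L) r := by
      intro r hr
      rw [hasDerivWithinAt_iff_tendsto_slope]
      set yr := UY r t y with hyr
      have hl : 𝓝[Icc 0 L \ {r}] r ≤ 𝓝[Icc 0 L] r := nhdsWithin_mono _ sdiff_subset
      have hcont : Tendsto (fun z => UY z r yr) (𝓝[Icc 0 L \ {r}] r) (𝓝 yr) := by
        have : Tendsto _ _ (𝓝 (UY r r yr)) := (h.continuousOn_sub r hr yr r hr).mono_left hl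
        rwa [h.refl_sub_apply hr] at this
      -- Varying r in the left factor U(t,r) is a backward increment. Applying U(z,r) to this curve
      -- cancels its U(r,z), which turns the increment into a forward one, accessible to
      -- `tendsto_slope`.
      have hw : Tendsto (fun z => UY r z (UY a b (UY z r yr))) (𝓝[Icc 0 L \ {r}] r)
          (𝓝 (UY a b yr)) :=
        h.tendsto_sub_right hr hl (((UY a b).continuous.tendsto _).comp hcont)
      have h1 := h.tendsto_slope hr (ψ ∘L U t r) hw
      have h2 := h.tendsto_slope hr (ψ ∘L U t r ∘L U a b) (tendsto_const_nhds (x := yr))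
      have h3 := h2.sub h1
      rw [h.generator_comm hc hr ha hb] at h3
      simp only [ContinuousLinearMap.comp_apply, sub_self] at h3
      refine h3.congr' ?_
      filter_upwards [self_mem_nhdsWithin] with z hz
      have hz := hz.1
      have h4 : U a b (U z t (J y) - U r t (J y)) -
          (U a b (U z t (J y)) - U r z (U a b (U z t (J y)))) =
          U r z (U a b (U z t (J y))) - U a b (U r t (J y)) := by
        rw [map_sub]; abel
      rw [slope_def_module, ← smul_sub, ← map_sub, ← map_sub (U t r), h.restrict r hr z hz,
        h.restrict a ha b hb, h.restrict z hz r hr, hyr, h.restrict r hr t ht,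
        h.comp_apply hz hr ht, h.comp_apply hz hr hz, h.refl_apply hz, h4, map_sub (U t r),
        h.comp_apply ht hr hz, map_sub ψ]
    -- Zero derivative, so the values at r = s and r = t agree: U(t,s)U(a,b)U(s,t) = U(a,b) on Y.
    have h1 := (convex_Icc 0 L).norm_image_sub_le_of_norm_hasDerivWithin_le (C := 0) hd
      (fun r _ => by simp) ht hs
    have h2 : ψ (U t s (U a b (U s t (J y)))) - ψ (U t t (U a b (U t t (J y)))) = 0 := by
      simpa using h1
    rw [sub_eq_zero.1 h2, h.refl_apply ht, h.refl_apply ht]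
  have key2 : ∀ v, U a b (U s t v) = U s t (U a b v) := by
    have := h.denseRange.equalizer ((U a b ∘L U s t).continuous) ((U s t ∘L U a b).continuous)
      (funext fun y => by
        have := congrArg (U s t) (key y)
        rw [h.comp_apply hs ht hs, h.refl_apply hs] at this
        simpa using this)
    intro v
    exact congrFun this v
  exact ContinuousLinearMap.ext key2

end IsEvolutionFamily

end Abstract

/-! ### Dunford–Riesz integrals as power series -/

section Logarithm

variable {X : Type*} [NormedAddCommGroup X] [NormedSpace ℂ X]

/-- X may be the zero space, where the identity has norm 0; hence the separate case n = 0. -/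
theorem norm_clm_pow_le (T : X →L[ℂ] X) (n : ℕ) : ‖T ^ n‖ ≤ ‖T‖ ^ n := by
  cases n with
  | zero => rw [pow_zero, pow_zero]; exact ContinuousLinearMap.norm_id_le
  | succ n => exact norm_pow_le' T n.succ_pos

theorem ring_inverse_eq {R : Type*} [Ring R] {a b : R} (hab : a * b = 1) (hba : b * a = 1) :
    Ring.inverse a = b :=
  Ring.inverse_unit ⟨a, b, hab, hba⟩

theorem summable_clm_pow [CompleteSpace X] {T : X →L[ℂ] X} (hT : ‖T‖ < 1) :
    Summable fun n : ℕ => T ^ n :=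
  .of_norm_bounded (summable_geometric_of_lt_one (norm_nonneg T) hT) (norm_clm_pow_le T)

/-- The Neumann series of the resolvent. -/
theorem hasSum_resolvent [CompleteSpace X] {T : X →L[ℂ] X} {c z : ℂ} (hT : ‖T‖ < ‖z - c‖) :
    HasSum (fun n : ℕ => ((z - c)⁻¹ ^ n * (z - c)⁻¹) • T ^ n)
      (resolvent (T + c • (1 : X →L[ℂ] X)) z) := by
  have h0 : 0 < ‖z - c‖ := (norm_nonneg T).trans_lt hT
  have hz : z - c ≠ 0 := norm_pos_iff.1 h0
  set S := (z - c)⁻¹ • T with hS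
  have hS1 : ‖S‖ < 1 := by
    rw [hS, norm_smul, norm_inv, inv_mul_lt_iff₀ h0, mul_one]; exact hT
  have hs := summable_clm_pow hS1
  have h1 : (algebraMap ℂ (X →L[ℂ] X) z - (T + c • (1 : X →L[ℂ] X))) = (z - c) • (1 - S) := by
    rw [Algebra.algebraMap_eq_smul_one, hS, smul_sub, smul_inv_smul₀ hz, sub_smul]; abel
  have hl := hs.tsum_pow_mul_one_sub
  have hr := hs.one_sub_mul_tsum_pow
  have h2 : resolvent (T + c • (1 : X →L[ℂ] X)) z = (z - c)⁻¹ • ∑' n : ℕ, S ^ n := by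
    rw [resolvent, h1]
    refine ring_inverse_eq ?_ ?_
    · rw [smul_mul_smul_comm, hr, mul_inv_cancel₀ hz, one_smul]
    · rw [smul_mul_smul_comm, hl, inv_mul_cancel₀ hz, one_smul]
  rw [h2]
  refine (hs.hasSum.const_smul (z - c)⁻¹).congr_fun fun n => ?_
  rw [hS, smul_pow, smul_smul, mul_comm]

/-- The power series of a Dunford-Riesz integral around the center of the circle. -/
theorem hasSum_dunford [CompleteSpace X] {f : ℂ → ℂ} {c : ℂ} {r : ℝ}
    (hf : CircleIntegrable f c r) {T : X →L[ℂ] X} (hT : ‖T‖ < r) :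
    HasSum (fun n : ℕ => (cauchyPowerSeries f c r).coeff n • T ^ n)
      ((2 * Real.pi * Complex.I : ℂ)⁻¹ •
        ∮ z in C(c, r), f z • resolvent (T + c • (1 : X →L[ℂ] X)) z) := by
  have hr : 0 < r := (norm_nonneg T).trans_lt hT
  have hq : ‖T‖ / r < 1 := (div_lt_one hr).2 hT
  have hq0 : 0 ≤ ‖T‖ / r := by positivity
  have key : HasSum (fun n : ℕ => ∮ z in C(c, r), ((z - c)⁻¹ ^ n • (z - c)⁻¹ • f z) • T ^ n)
      (∮ z in C(c, r), f z • resolvent (T + c • (1 : X →L[ℂ] X)) z) := by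
    -- On the circle ‖(z − c)⁻¹‖ = r⁻¹, and the factor r of dz cancels one of the n + 1 inverses,
    -- which leaves a geometric bound.
    refine intervalIntegral.hasSum_integral_of_dominated_convergence
      (fun n θ => ‖f (circleMap c r θ)‖ * (‖T‖ / r) ^ n) (fun n => ?_) (fun n => ?_) ?_ ?_ ?_
    · simp only [deriv_circleMap]
      have m1 : AEStronglyMeasurable (fun θ => f (circleMap c r θ))
          (volume.restrict (uIoc 0 (2 * Real.pi))) := hf.def'.1
      have m2 : Measurable fun θ => circleMap c r θ - c := by fun_prop
      have m3 : Measurable fun θ => circleMap 0 r θ * Complex.I := by fun_prop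
      exact m3.aestronglyMeasurable.smul ((((m2.inv.pow_const n).aestronglyMeasurable).smul
        (m2.inv.aestronglyMeasurable.smul m1)).smul_const _)
    · refine Eventually.of_forall fun θ _ => ?_
      simp only [deriv_circleMap, norm_smul, norm_mul, norm_circleMap_zero, Complex.norm_I,
        circleMap_sub_center, norm_pow, norm_inv, abs_of_pos hr, mul_one]
      have := norm_clm_pow_le T n
      calc r * (r⁻¹ ^ n * (r⁻¹ * ‖f (circleMap c r θ)‖) * ‖T ^ n‖)
          = ‖f (circleMap c r θ)‖ * (r⁻¹ ^ n * ‖T ^ n‖) := by field_simp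
        _ ≤ ‖f (circleMap c r θ)‖ * (r⁻¹ ^ n * ‖T‖ ^ n) := by gcongr
        _ = _ := by rw [← mul_pow, div_eq_inv_mul]
    · exact Eventually.of_forall fun _ _ => (summable_geometric_of_lt_one hq0 hq).mul_left _
    · simpa only [tsum_mul_left, tsum_geometric_of_lt_one hq0 hq] using
        hf.norm.mul_continuousOn continuousOn_const
    · refine Eventually.of_forall fun θ _ => HasSum.const_smul _ ?_
      have h1 : ‖T‖ < ‖circleMap c r θ - c‖ := by simpa [abs_of_pos hr] using hT
      refine ((hasSum_resolvent h1).const_smul (f (circleMap c r θ))).congr_fun fun n => ?_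
      simp only [smul_smul, smul_eq_mul]
      congr 1; ring
  refine (key.const_smul (2 * Real.pi * Complex.I : ℂ)⁻¹).congr_fun fun n => ?_
  rw [circleIntegral.integral_smul_const, smul_smul]
  congr 1
  have h1 := cauchyPowerSeries_apply f c r n 1
  simp only [one_div, smul_eq_mul] at h1 ⊢
  exact h1

theorem lt_norm_of_closedBall_subset_slitPlane {κ : ℂ} {r : ℝ} (h : Metric.closedBall κ r ⊆ Complex.slitPlane) :
    r < ‖κ‖ := by
  by_contra! h1
  exact Complex.zero_notMem_slitPlane (h (by simpa [Metric.mem_closedBall, dist_eq_norm] using h1))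

/-- Power series at a point are unique, so only the germ at κ matters. There log z = log κ + log(1 +
(z−κ)/κ): as arg κ < π strictly, the two arguments add up without leaving (−π, π]. -/
theorem cauchyPowerSeries_log_coeff {κ : ℂ} {r : ℝ} (hr : 0 < r)
    (h : Metric.closedBall κ r ⊆ Complex.slitPlane) (n : ℕ) :
    (cauchyPowerSeries Complex.log κ r).coeff n =
      if n = 0 then Complex.log κ else (-1) ^ (n + 1) / (n * κ ^ n) := by
  have hκ : κ ∈ Complex.slitPlane := h (Metric.mem_closedBall_self hr.le)
  have hκ0 : κ ≠ 0 := Complex.slitPlane_ne_zero hκ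
  lift r to NNReal using hr.le
  have h1 : HasFPowerSeriesAt Complex.log (cauchyPowerSeries Complex.log κ r) κ := by
    have : DiffContOnCl ℂ Complex.log (Metric.ball κ r) := by
      refine DifferentiableOn.diffContOnCl fun z hz => ?_
      have hz' := h (Metric.closure_ball_subset_closedBall hz)
      exact (Complex.differentiableAt_log hz').differentiableWithinAt
    exact (this.hasFPowerSeriesOnBall (by exact_mod_cast hr)).hasFPowerSeriesAt
  let d : ℕ → ℂ := fun n => if n = 0 then Complex.log κ else (-1) ^ (n + 1) / (n * κ ^ n)
  have h2 : HasFPowerSeriesAt Complex.log (FormalMultilinearSeries.ofScalars ℂ d) κ := by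
    rw [hasFPowerSeriesAt_iff']
    have e1 : ∀ᶠ z in 𝓝 κ, ‖(z - κ) / κ‖ < 1 := by
      have : Tendsto (fun z : ℂ => ‖(z - κ) / κ‖) (𝓝 κ) (𝓝 ‖(κ - κ) / κ‖) :=
        Continuous.tendsto (by fun_prop) κ
      exact this.eventually_lt_const (by simp)
    have e2 : ∀ᶠ z in 𝓝 κ, Complex.log z = Complex.log κ + Complex.log (1 + (z - κ) / κ) := by
      have t : Tendsto (fun z : ℂ => 1 + (z - κ) / κ) (𝓝 κ) (𝓝 1) := by
        have : Tendsto (fun z : ℂ => 1 + (z - κ) / κ) (𝓝 κ) (𝓝 (1 + (κ - κ) / κ)) :=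
          Continuous.tendsto (by fun_prop) κ
        simpa using this
      have t1 : Tendsto (fun z : ℂ => κ.arg + (1 + (z - κ) / κ).arg) (𝓝 κ) (𝓝 κ.arg) := by
        have := ((Complex.continuousAt_arg Complex.one_mem_slitPlane).tendsto.comp t).const_add
          κ.arg
        simpa using this
      have t2 : ∀ᶠ z in 𝓝 κ, κ.arg + (1 + (z - κ) / κ).arg ∈ Ioc (-Real.pi) Real.pi := by
        refine t1.eventually (Ioc_mem_nhds (Complex.neg_pi_lt_arg κ) ?_)
        exact lt_of_le_of_ne (Complex.arg_le_pi κ) (Complex.mem_slitPlane_iff_arg.1 hκ).1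
      filter_upwards [t2, t.eventually_ne one_ne_zero] with z hz hz0
      rw [← Complex.log_mul hκ0 hz0 hz]
      congr 1; field_simp; ring
    filter_upwards [e1, e2] with z hz1 hz2
    rw [hz2]
    have h3 := (Complex.hasSum_taylorSeries_log hz1).add (hasSum_ite_eq 0 (Complex.log κ))
    rw [add_comm (Complex.log κ)]
    refine h3.congr_fun fun n => ?_
    rw [FormalMultilinearSeries.coeff_ofScalars]
    rcases eq_or_ne n 0 with rfl | hn
    · simp [d]
    · simp only [d, hn, if_false, smul_eq_mul, div_pow, add_zero]
      field_simp
  have h3 := h1.eq_formalMultilinearSeries h2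
  rw [h3, FormalMultilinearSeries.coeff_ofScalars]

end Logarithm

/-! ### The exponential of the operator logarithm -/

section Logarithm

variable {X : Type*} [NormedAddCommGroup X] [NormedSpace ℂ X]

/-- By commutation exp(ℓ t) = exp(ℓ s) exp(ℓ t − ℓ s), and exp has derivative the identity at 0. -/
theorem hasDerivAt_exp_of_commute {𝔸 : Type*} [NormedRing 𝔸] [NormedAlgebra ℂ 𝔸]
    [CompleteSpace 𝔸] {ℓ : ℂ → 𝔸} {ℓ' : 𝔸} {s : ℂ} (hℓ : HasDerivAt ℓ ℓ' s)
    (hc : ∀ t, Commute (ℓ s) (ℓ t)) :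
    HasDerivAt (fun t => NormedSpace.exp (ℓ t)) (NormedSpace.exp (ℓ s) * ℓ') s := by
  let _ : NormedAlgebra ℚ 𝔸 := NormedAlgebra.restrictScalars ℚ ℂ 𝔸
  have h0 : HasFDerivAt (NormedSpace.exp : 𝔸 → 𝔸) (1 : 𝔸 →L[ℂ] 𝔸) (ℓ s - ℓ s) := by
    rw [sub_self]; exact hasFDerivAt_exp_zero
  have h1 := (h0.comp_hasDerivAt s (hℓ.sub_const (ℓ s))).const_mul (NormedSpace.exp (ℓ s))
  refine h1.congr_of_eventuallyEq (Eventually.of_forall fun t => ?_)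
  simp only [Function.comp_apply]
  rw [← NormedSpace.exp_add_of_commute ((hc t).sub_right (Commute.refl _)), add_sub_cancel]

/-- The Mercator series inverts the exponential. -/
theorem exp_mercator [CompleteSpace X] {T : X →L[ℂ] X} (hT : ‖T‖ < 1) :
    NormedSpace.exp (∑' n : ℕ, ((-1) ^ n / (n + 1 : ℂ)) • T ^ (n + 1)) = 1 + T := by
  let _ : NormedAlgebra ℚ (X →L[ℂ] X) := NormedAlgebra.restrictScalars ℚ ℂ _
  -- Any ρ with ρ > 1 and ρ‖T‖ < 1 would do: the endpoint s = 1 becomes interior and the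
  -- differentiated series still converges.
  set ρ : ℝ := 2 / (1 + ‖T‖) with hρ
  have hp : 0 < 1 + ‖T‖ := by positivity
  have hρ1 : 1 < ρ := by rw [hρ, lt_div_iff₀ hp]; linarith
  have hρT : ρ * ‖T‖ < 1 := by rw [hρ, div_mul_eq_mul_div, div_lt_one hp]; linarith
  have hρ0 : 0 < ρ := by linarith
  let g : ℕ → ℂ → X →L[ℂ] X := fun n s => ((-1) ^ n / (n + 1 : ℂ)) • s ^ (n + 1) • T ^ (n + 1)
  let g' : ℕ → ℂ → X →L[ℂ] X := fun n s => ((-1) ^ n * s ^ n) • T ^ (n + 1)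
  let ℓ : ℂ → X →L[ℂ] X := fun s => ∑' n, g n s
  have hsum : ∀ s ∈ Metric.ball (0 : ℂ) ρ, ‖(-s) • T‖ < 1 := fun s hs => by
    rw [norm_smul, norm_neg]
    have : ‖s‖ < ρ := by simpa using hs
    exact lt_of_le_of_lt (by gcongr) hρT
  have hder : ∀ s ∈ Metric.ball (0 : ℂ) ρ, HasDerivAt ℓ (∑' n, g' n s) s := fun s hs =>
    hasDerivAt_tsum_of_isPreconnected (u := fun n : ℕ => (ρ * ‖T‖) ^ n * ‖T‖)
      ((summable_geometric_of_lt_one (by positivity) hρT).mul_right _) Metric.isOpen_ball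
      (convex_ball (0 : ℂ) ρ).isPreconnected
      (fun n y _ => by
        have h1 := ((hasDerivAt_pow (n + 1) y).smul_const (T ^ (n + 1))).const_smul
          ((-1) ^ n / (n + 1 : ℂ))
        refine h1.congr_deriv ?_
        simp only [g', smul_smul]
        congr 1
        have : (n + 1 : ℂ) ≠ 0 := Nat.cast_add_one_ne_zero n
        push_cast
        field_simp)
      (fun n y hy => by
        have hy' : ‖y‖ ≤ ρ := by simpa using (Metric.ball_subset_closedBall hy)
        simp only [g', norm_smul, norm_mul, norm_pow, norm_neg, norm_one, one_pow, one_mul]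
        calc ‖y‖ ^ n * ‖T ^ (n + 1)‖ ≤ ρ ^ n * ‖T‖ ^ (n + 1) := by
              gcongr; exact norm_clm_pow_le T _
          _ = _ := by rw [mul_pow, pow_succ]; ring)
      (Metric.mem_ball_self hρ0) (by simp [g, summable_zero]) hs
  have hmul : ∀ s ∈ Metric.ball (0 : ℂ) ρ, (∑' n, g' n s) * (1 + s • T) = T := fun s hs => by
    have h1 := summable_clm_pow (hsum s hs)
    have h2 : ∀ n, g' n s = T * ((-s) • T) ^ n := fun n => by
      simp only [g']
      rw [smul_pow, mul_smul_comm, ← pow_succ', neg_pow s n]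
    simp_rw [h2]
    rw [h1.tsum_mul_left, mul_assoc]
    have h3 := h1.tsum_pow_mul_one_sub
    rw [neg_smul, sub_neg_eq_add] at h3
    simp only [neg_smul]
    rw [h3, mul_one]
  have hcomm : ∀ s t, Commute (ℓ s) (ℓ t) := fun s t =>
    Commute.tsum_left _ fun n => Commute.tsum_right _ fun m => by
      simp only [g]
      exact ((((Commute.refl T).pow_pow _ _).smul_left _).smul_left _).smul_right _ |>.smul_right _
  -- By `hmul`, ℓ'(s)(1 + sT) = T, so the two terms of the product rule cancel.
  have hconst : ∀ s ∈ Metric.ball (0 : ℂ) ρ,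
      HasDerivWithinAt (fun s => NormedSpace.exp (-ℓ s) * (1 + s • T)) 0
        (Metric.ball (0 : ℂ) ρ) s := fun s hs => by
    have h1 := hasDerivAt_exp_of_commute (hder s hs).neg
      (fun t => ((hcomm s t).neg_left).neg_right)
    have h2 : HasDerivAt (fun s : ℂ => 1 + s • T) T s := by
      simpa using ((hasDerivAt_id s).smul_const T).const_add (1 : X →L[ℂ] X)
    refine ((h1.mul h2).congr_deriv ?_).hasDerivWithinAt
    simp only [Pi.neg_apply]
    rw [mul_assoc, ← mul_add, neg_mul, hmul s hs, neg_add_cancel, mul_zero]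
  have h1 := (convex_ball (0 : ℂ) ρ).norm_image_sub_le_of_norm_hasDerivWithin_le (C := 0) hconst
    (fun r _ => by simp) (Metric.mem_ball_self hρ0)
    (show (1 : ℂ) ∈ Metric.ball (0 : ℂ) ρ by simpa using hρ1)
  have hℓ0 : ℓ 0 = 0 := by simp [ℓ, g]
  have hℓ1 : ℓ 1 = ∑' n : ℕ, ((-1) ^ n / (n + 1 : ℂ)) • T ^ (n + 1) := by simp [ℓ, g]
  have h2 : NormedSpace.exp (-ℓ 1) * (1 + T) = 1 := by
    simpa [hℓ0, sub_eq_zero] using h1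
  rw [← hℓ1]
  have h3 : NormedSpace.exp (ℓ 1) * NormedSpace.exp (-ℓ 1) = 1 := by
    rw [← NormedSpace.exp_add_of_commute ((Commute.refl (ℓ 1)).neg_right), add_neg_cancel,
      NormedSpace.exp_zero]
  calc NormedSpace.exp (ℓ 1) = NormedSpace.exp (ℓ 1) * (NormedSpace.exp (-ℓ 1) * (1 + T)) := by
        rw [h2, mul_one]
    _ = 1 + T := by rw [← mul_assoc, h3, one_mul]

/-- The coefficients of the Taylor series of the principal logarithm at `κ`, from degree one. -/
noncomputable def logCoeff (κ : ℂ) (n : ℕ) : ℂ := (-1) ^ n / ((n + 1) * κ ^ (n + 1))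

/-- The factor n + 1 is the number of terms in the n-th divided difference; the coefficient absorbs
it exactly. -/
theorem norm_logCoeff (κ : ℂ) (n : ℕ) : (n + 1) * ‖logCoeff κ n‖ = ‖κ‖⁻¹ ^ (n + 1) := by
  have h : ‖(n + 1 : ℂ)‖ = n + 1 := by exact_mod_cast Complex.norm_natCast (n + 1)
  have h' : (n + 1 : ℝ) ≠ 0 := Nat.cast_add_one_ne_zero n
  rw [logCoeff, norm_div, norm_mul, h]
  simp only [norm_pow, norm_neg, norm_one, one_pow, inv_pow]
  rw [one_div, mul_inv, mul_inv_cancel_left₀ h']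

/-- The constant term Log κ is split off: it cancels in differences and is exponentiated separately.
-/
theorem hasSum_dunfordLog [CompleteSpace X] {κ : ℂ} {r : ℝ} {T : X →L[ℂ] X}
    (h : Metric.closedBall κ r ⊆ Complex.slitPlane) (hT : ‖T‖ < r) :
    HasSum (fun n => logCoeff κ n • T ^ (n + 1))
      (dunfordLog κ r (T + κ • (1 : X →L[ℂ] X)) - Complex.log κ • (1 : X →L[ℂ] X)) := by
  have hr : 0 < r := (norm_nonneg T).trans_lt hT
  have hi : CircleIntegrable Complex.log κ r :=
    ContinuousOn.circleIntegrable hr.le fun z hz =>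
      (Complex.differentiableAt_log (h (Metric.sphere_subset_closedBall hz))).continuousAt
        |>.continuousWithinAt
  have h0 := hasSum_dunford hi hT
  have h1 := (hasSum_nat_add_iff' 1).2 h0
  have h2 : ∀ n : ℕ, (cauchyPowerSeries Complex.log κ r).coeff (n + 1) = logCoeff κ n := fun n => by
    rw [cauchyPowerSeries_log_coeff hr h, if_neg n.succ_ne_zero, logCoeff, pow_add (-1 : ℂ) n 2]
    push_cast
    ring
  have h3 : (cauchyPowerSeries Complex.log κ r).coeff 0 = Complex.log κ := by
    rw [cauchyPowerSeries_log_coeff hr h, if_pos rfl]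
  simp only [h2, h3, Finset.sum_range_one, pow_zero] at h1
  exact h1

/-- Write T + κ = κ(1 + κ⁻¹T); since ‖T‖ < r < |κ|, the remaining series is the Mercator series of
κ⁻¹T. -/
theorem exp_dunfordLog [CompleteSpace X] {κ : ℂ} {r : ℝ} {T : X →L[ℂ] X}
    (h : Metric.closedBall κ r ⊆ Complex.slitPlane) (hT : ‖T‖ < r) :
    NormedSpace.exp (dunfordLog κ r (T + κ • (1 : X →L[ℂ] X))) = T + κ • (1 : X →L[ℂ] X) := by
  let _ : NormedAlgebra ℚ (X →L[ℂ] X) := NormedAlgebra.restrictScalars ℚ ℂ _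
  have hκr := lt_norm_of_closedBall_subset_slitPlane h
  have hκ : κ ≠ 0 := norm_pos_iff.1 ((norm_nonneg T).trans_lt (hT.trans hκr))
  have hT1 : ‖κ⁻¹ • T‖ < 1 := by
    rw [norm_smul, norm_inv, inv_mul_lt_iff₀ (norm_pos_iff.2 hκ), mul_one]
    exact hT.trans hκr
  have h1 := (hasSum_dunfordLog h hT).tsum_eq
  have h2 : ∀ n, logCoeff κ n • T ^ (n + 1) =
      ((-1) ^ n / (n + 1 : ℂ)) • (κ⁻¹ • T) ^ (n + 1) := fun n => by
    rw [smul_pow, smul_smul, logCoeff, inv_pow, div_mul_eq_div_div, ← div_eq_mul_inv]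
  simp_rw [h2] at h1
  rw [eq_sub_iff_add_eq] at h1
  rw [← h1, NormedSpace.exp_add_of_commute (((Commute.one_right _).smul_right _)),
    exp_mercator hT1, ← Algebra.algebraMap_eq_smul_one, ← NormedSpace.algebraMap_exp_comm,
    ← Complex.exp_eq_exp_ℂ, Complex.exp_log hκ, Algebra.algebraMap_eq_smul_one]
  rw [add_mul, one_mul, smul_mul_smul_comm, inv_mul_cancel₀ hκ, mul_one, one_smul, add_comm]

end Logarithm

/-! ### The logarithmic representation of the generator -/

section LogarithmicRepresentation

variable {X : Type*} [NormedAddCommGroup X] [NormedSpace ℂ X]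
variable {Y : Type*} [NormedAddCommGroup Y] [NormedSpace ℂ Y]

/-- The divided difference of the series of `Log (S + κ)` at `S` and `T`, applied to `y`. -/
noncomputable def logQuotient (κ : ℂ) (S T : Y →L[ℂ] Y) (y : Y) : Y :=
  ∑' n, logCoeff κ n • ∑ k ∈ Finset.range (n + 1), (S ^ k) ((T ^ (n - k)) y)

theorem norm_logQuotient_term_le {κ : ℂ} {M : ℝ} {S T : Y →L[ℂ] Y} (hS : ‖S‖ ≤ M) (hT : ‖T‖ ≤ M)
    (y : Y) (n : ℕ) :
    ‖logCoeff κ n • ∑ k ∈ Finset.range (n + 1), (S ^ k) ((T ^ (n - k)) y)‖ ≤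
      (M * ‖κ‖⁻¹) ^ n * (‖κ‖⁻¹ * ‖y‖) := by
  have hM : 0 ≤ M := (norm_nonneg S).trans hS
  have h1 : ∀ k ∈ Finset.range (n + 1), ‖(S ^ k) ((T ^ (n - k)) y)‖ ≤ M ^ n * ‖y‖ := by
    intro k hk
    have hk' : k ≤ n := Nat.lt_succ_iff.1 (Finset.mem_range.1 hk)
    calc ‖(S ^ k) ((T ^ (n - k)) y)‖ ≤ ‖S ^ k‖ * (‖T ^ (n - k)‖ * ‖y‖) :=
          ((S ^ k).le_opNorm _).trans (by gcongr; exact (T ^ (n - k)).le_opNorm y)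
      _ ≤ M ^ k * (M ^ (n - k) * ‖y‖) := by
          gcongr
          · exact (norm_clm_pow_le S k).trans (by gcongr)
          · exact (norm_clm_pow_le T _).trans (by gcongr)
      _ = M ^ n * ‖y‖ := by rw [← mul_assoc, ← pow_add, Nat.add_sub_cancel' hk']
  calc _ ≤ ‖logCoeff κ n‖ * ((n + 1) * (M ^ n * ‖y‖)) := by
        rw [norm_smul]
        gcongr
        refine (norm_sum_le_of_le _ h1).trans ?_
        simp
    _ = ((n + 1) * ‖logCoeff κ n‖) * (M ^ n * ‖y‖) := by ring
    _ = _ := by rw [norm_logCoeff, mul_pow, pow_succ]; ring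

theorem summable_logQuotient_bound {κ : ℂ} {M : ℝ} (hM : 0 ≤ M) (hκ : M < ‖κ‖) (b : ℝ) :
    Summable fun n : ℕ => (M * ‖κ‖⁻¹) ^ n * b := by
  refine (summable_geometric_of_lt_one (by positivity) ?_).mul_right _
  rw [← div_eq_mul_inv, div_lt_one (hM.trans_lt hκ)]
  exact hκ

theorem hasSum_logQuotient [CompleteSpace Y] {κ : ℂ} {M : ℝ} {S T : Y →L[ℂ] Y} (hS : ‖S‖ ≤ M)
    (hT : ‖T‖ ≤ M) (hκ : M < ‖κ‖) (y : Y) :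
    HasSum (fun n => logCoeff κ n • ∑ k ∈ Finset.range (n + 1), (S ^ k) ((T ^ (n - k)) y))
      (logQuotient κ S T y) :=
  (Summable.of_norm_bounded (summable_logQuotient_bound ((norm_nonneg S).trans hS) hκ _)
    (norm_logQuotient_term_le hS hT y)).hasSum

/-- On the diagonal the divided difference of Log is its derivative, here the Neumann series of (T +
κ)⁻¹. -/
theorem logQuotient_self [CompleteSpace Y] {κ : ℂ} {M : ℝ} {T : Y →L[ℂ] Y} (hT : ‖T‖ ≤ M)
    (hκ : M < ‖κ‖) (y : Y) : T (logQuotient κ T T y) + κ • logQuotient κ T T y = y := by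
  have hκ0 : κ ≠ 0 := norm_pos_iff.1 (((norm_nonneg T).trans hT).trans_lt hκ)
  have h1 : ‖-(κ⁻¹ • T)‖ < 1 := by
    rw [norm_neg, norm_smul, norm_inv, inv_mul_lt_iff₀ (norm_pos_iff.2 hκ0), mul_one]
    exact hT.trans_lt hκ
  have hs := summable_clm_pow h1
  have h2 : ∀ n, logCoeff κ n • ∑ k ∈ Finset.range (n + 1), (T ^ k) ((T ^ (n - k)) y) =
      κ⁻¹ • ((-(κ⁻¹ • T)) ^ n) y := fun n => by
    have h3 : ∀ k ∈ Finset.range (n + 1), (T ^ k) ((T ^ (n - k)) y) = (T ^ n) y := by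
      intro k hk
      have hk' : k ≤ n := Nat.lt_succ_iff.1 (Finset.mem_range.1 hk)
      rw [← mul_apply_eq_comp, ← pow_add, Nat.add_sub_cancel' hk']
    have h4 : (n + 1 : ℂ) ≠ 0 := Nat.cast_add_one_ne_zero n
    rw [Finset.sum_congr rfl h3, Finset.sum_const, Finset.card_range, ← Nat.cast_smul_eq_nsmul ℂ,
      smul_smul, ← neg_smul, smul_pow, smul_apply, smul_smul, logCoeff]
    congr 1
    push_cast
    rw [neg_pow κ⁻¹, inv_pow]
    field_simp
    ring
  have h5 : logQuotient κ T T y = κ⁻¹ • (∑' n : ℕ, (-(κ⁻¹ • T)) ^ n) y := by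
    refine (hasSum_logQuotient hT hT hκ y).unique ?_
    simp_rw [h2]
    exact (hs.hasSum.mapL (ContinuousLinearMap.apply ℂ Y y)).const_smul κ⁻¹
  have h6 := congrArg (fun S : Y →L[ℂ] Y => S y) hs.one_sub_mul_tsum_pow
  simp only [sub_neg_eq_add, mul_apply_eq_comp, add_apply,
    one_apply_eq_self, smul_apply] at h6
  rw [h5, map_smul, smul_inv_smul₀ hκ0, add_comm]
  exact h6

theorem tendsto_pow_apply {ι : Type*} {l : Filter ι} {S : ι → Y →L[ℂ] Y} {S₀ : Y →L[ℂ] Y} {M : ℝ}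
    (hM : ∀ᶠ i in l, ‖S i‖ ≤ M) (hS : ∀ y, Tendsto (fun i => S i y) l (𝓝 (S₀ y))) (k : ℕ) (y : Y) :
    Tendsto (fun i => (S i ^ k) y) l (𝓝 ((S₀ ^ k) y)) := by
  induction k with
  | zero => simpa using tendsto_const_nhds
  | succ k ih =>
    simp only [pow_succ', mul_apply_eq_comp]
    exact tendsto_clm_apply_of_bounded hM (hS _) ih

/-- Each term converges strongly, and one geometric series dominates all of them. The convergence is
in Y, as `tendsto_slope` requires. -/
theorem tendsto_logQuotient [CompleteSpace Y] {ι : Type*} {l : Filter ι} {S : ι → Y →L[ℂ] Y}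
    {T : Y →L[ℂ] Y} {κ : ℂ} {M : ℝ} (hM : ∀ᶠ i in l, ‖S i‖ ≤ M) (hT : ‖T‖ ≤ M) (hκ : M < ‖κ‖)
    (hS : ∀ y, Tendsto (fun i => S i y) l (𝓝 (T y))) (y : Y) :
    Tendsto (fun i => logQuotient κ (S i) T y) l (𝓝 (logQuotient κ T T y)) :=
  tendsto_tsum_of_dominated_convergence
    (summable_logQuotient_bound ((norm_nonneg T).trans hT) hκ (‖κ‖⁻¹ * ‖y‖))
    (fun _ => (tendsto_finsetSum _ fun k _ => tendsto_pow_apply hM hS k _).const_smul _)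
    (hM.mono fun _ hi n => norm_logQuotient_term_le hi hT y n)

/-- A difference of logarithms of commuting operators factors through `logQuotient`. -/
theorem dunfordLog_sub_apply [CompleteSpace X] [CompleteSpace Y] {J : Y →L[ℂ] X}
    {S T : X →L[ℂ] X} {SY TY : Y →L[ℂ] Y} (hJS : ∀ y, J (SY y) = S (J y))
    (hJT : ∀ y, J (TY y) = T (J y)) (hST : Commute S T) {κ : ℂ} {r M : ℝ}
    (h : Metric.closedBall κ r ⊆ Complex.slitPlane) (hM : M < r) (hS : ‖S‖ ≤ M) (hT : ‖T‖ ≤ M)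
    (hSY : ‖SY‖ ≤ M) (hTY : ‖TY‖ ≤ M) (y : Y) :
    dunfordLog κ r (S + κ • (1 : X →L[ℂ] X)) (J y) -
        dunfordLog κ r (T + κ • (1 : X →L[ℂ] X)) (J y) =
      S (J (logQuotient κ SY TY y)) - T (J (logQuotient κ SY TY y)) := by
  have hpow : ∀ {R : X →L[ℂ] X} {RY : Y →L[ℂ] Y}, (∀ y, J (RY y) = R (J y)) → ∀ (k : ℕ) (y : Y),
      J ((RY ^ k) y) = (R ^ k) (J y) := by
    intro R RY hR k
    induction k with
    | zero => simp
    | succ k ih => intro y; simp only [pow_succ', mul_apply_eq_comp, hR, ih]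
  have h1 := ((hasSum_dunfordLog h (hS.trans_lt hM)).sub
    (hasSum_dunfordLog h (hT.trans_lt hM))).mapL (ContinuousLinearMap.apply ℂ X (J y))
  have h2 := (hasSum_logQuotient hSY hTY (hM.trans (lt_norm_of_closedBall_subset_slitPlane h)) y).mapL
    ((S - T) ∘L J)
  have h3 := h1.unique (h2.congr_fun fun n => ?_)
  · simpa using h3
  -- Commutativity is used here: S^(n+1) − T^(n+1) = (S − T) Σ S^k T^(n−k).
  · have h4 := congrArg (fun R : X →L[ℂ] X => R (J y)) (hST.mul_geom_sum₂ (n + 1))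
    simp only [mul_apply_eq_comp, sum_apply,
      Nat.add_sub_cancel] at h4
    have h5 : J (∑ k ∈ Finset.range (n + 1), (SY ^ k) ((TY ^ (n - k)) y)) =
        ∑ k ∈ Finset.range (n + 1), (S ^ k) ((T ^ (n - k)) (J y)) := by
      rw [map_sum]
      exact Finset.sum_congr rfl fun k _ => by rw [hpow hJS, hpow hJT]
    rw [← smul_sub, map_smul, map_smul, ContinuousLinearMap.apply_apply, ← h4,
      ContinuousLinearMap.comp_apply, h5]

variable {L : ℝ} {J : Y →L[ℂ] X} {U : ℝ → ℝ → X →L[ℂ] X} {UY : ℝ → ℝ → Y →L[ℂ] Y}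
  {A : ℝ → Y →ₗ[ℂ] X}

/-- The increment of the logarithm is (U(z,x) − I) applied to U(x,ξ)Q(z)y, with Q(z) the divided
difference at U(z,ξ) and U(x,ξ). This vector converges in Y, so the weak generator passes to the
limit. -/
theorem IsEvolutionFamily.hasWeakDerivWithinAt_logOp [CompleteSpace X] [CompleteSpace Y]
    (h : IsEvolutionFamily L J U UY A) (hc : Commutes L U UY A) {κ : ℂ} {r : ℝ}
    (hκ : IsLogContour L U UY κ r) {x ξ : ℝ} (hx : x ∈ Icc 0 L) (hξ : ξ ∈ Icc 0 L) (y : Y) :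
    HasWeakDerivWithinAt (fun z => logOp U κ r z ξ (J y))
      (A x (UY x ξ (logQuotient κ (UY x ξ) (UY x ξ) y))) (Icc 0 L) x := by
  obtain ⟨hball, M, hM, hU⟩ := hκ
  intro φ
  rw [hasDerivWithinAt_iff_tendsto_slope]
  have hl : 𝓝[Icc 0 L \ {x}] x ≤ 𝓝[Icc 0 L] x := nhdsWithin_mono _ sdiff_subset
  have hmem : ∀ᶠ z in 𝓝[Icc 0 L \ {x}] x, z ∈ Icc 0 L := hl self_mem_nhdsWithin
  have hq : Tendsto (fun z => logQuotient κ (UY z ξ) (UY x ξ) y) (𝓝[Icc 0 L \ {x}] x)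
      (𝓝 (logQuotient κ (UY x ξ) (UY x ξ) y)) :=
    tendsto_logQuotient (hmem.mono fun z hz => (hU z hz ξ hξ).2) (hU x hx ξ hξ).2
      (hM.trans (lt_norm_of_closedBall_subset_slitPlane hball))
      (fun v => (h.continuousOn_sub ξ hξ v x hx).mono_left hl) y
  refine (h.tendsto_slope hx φ (((UY x ξ).continuous.tendsto _).comp hq)).congr' ?_
  filter_upwards [hmem] with z hz
  rw [slope_def_module, ← map_sub]
  simp only [logOp, Function.comp_apply]
  rw [dunfordLog_sub_apply (h.restrict z hz ξ hξ) (h.restrict x hx ξ hξ)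
    (h.commute hc hz hξ hx hξ) hball hM (hU z hz ξ hξ).1 (hU x hx ξ hξ).1 (hU z hz ξ hξ).2
    (hU x hx ξ hξ).2, h.restrict x hx ξ hξ, h.comp_apply hz hx hξ]

theorem HasWeakDerivWithinAt.unique {f : ℝ → X} {v v' : X} {x : ℝ} (hL : 0 < L)
    (hx : x ∈ Icc 0 L) (h : HasWeakDerivWithinAt f v (Icc 0 L) x)
    (h' : HasWeakDerivWithinAt f v' (Icc 0 L) x) : v = v' :=
  (SeparatingDual.eq_iff_forall_dual_eq (R := ℂ)).2 fun φ =>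
    (uniqueDiffOn_Icc hL x hx).eq_deriv _ (h φ) (h' φ)

theorem IsEvolutionFamily.hasWeakDerivWithinAt_orbit [CompleteSpace Y]
    (h : IsEvolutionFamily L J U UY A) {x ξ : ℝ} (hx : x ∈ Icc 0 L) (hξ : ξ ∈ Icc 0 L) (y : Y) :
    HasWeakDerivWithinAt (fun z => U z ξ (J y)) (A x (UY x ξ y)) (Icc 0 L) x := by
  intro φ
  refine (h.generator x hx (UY x ξ y) φ).congr (fun z hz => ?_) ?_
  · simp only [h.restrict x hx ξ hξ, h.comp_apply hz hx hξ]
  · simp only [h.restrict x hx ξ hξ, h.comp_apply hx hx hξ]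

theorem IsEvolutionFamily.exists_isLogContour (h : IsEvolutionFamily L J U UY A) :
    ∃ (κ : ℂ) (r : ℝ), IsLogContour L U UY κ r := by
  obtain ⟨C, hC, hU⟩ := h.exists_bound
  -- The disc of radius C + 1 about C + 2 lies in Re z ≥ 1.
  refine ⟨((C + 2 : ℝ) : ℂ), C + 1, fun z hz => Or.inl ?_, C, by linarith, hU⟩
  have h1 : |(z - ((C + 2 : ℝ) : ℂ)).re| ≤ C + 1 :=
    (Complex.abs_re_le_norm _).trans (by rwa [Metric.mem_closedBall, dist_eq_norm] at hz)
  rw [Complex.sub_re, Complex.ofReal_re] at h1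
  linarith [(abs_le.1 h1).1]

theorem spectrum_add_smul_one_subset_ball [CompleteSpace X] {T : X →L[ℂ] X} {κ : ℂ} {r : ℝ}
    (hT : ‖T‖ < r) : spectrum ℂ (T + κ • (1 : X →L[ℂ] X)) ⊆ Metric.ball κ r := by
  intro z hz
  by_contra hzr
  have h1 : ‖T‖ < ‖z - κ‖ := by
    rw [Metric.mem_ball, dist_eq_norm, not_lt] at hzr
    exact hT.trans_le hzr
  have h2 : z - κ ∈ resolventSet ℂ T := spectrum.mem_resolventSet_of_norm_lt_mul <|
    lt_of_le_of_lt (mul_le_of_le_one_right (norm_nonneg T) ContinuousLinearMap.norm_id_le) h1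
  refine hz ?_
  rw [spectrum.mem_resolventSet_iff] at h2 ⊢
  convert h2 using 1
  rw [Algebra.algebraMap_eq_smul_one, Algebra.algebraMap_eq_smul_one, sub_smul]
  abel

/-- The logarithmic representation of the generator of a commuting invertible evolution family. -/
theorem IsEvolutionFamily.logarithmic_representation [CompleteSpace X] [CompleteSpace Y]
    (hL : 0 < L) (h : IsEvolutionFamily L J U UY A) (hc : Commutes L U UY A) {κ : ℂ} {r : ℝ}
    (hκ : IsLogContour L U UY κ r) {x ξ : ℝ} (hx : x ∈ Icc 0 L) (hξ : ξ ∈ Icc 0 L) :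
    spectrum ℂ (U x ξ + κ • (1 : X →L[ℂ] X)) ⊆ Metric.ball κ r ∧
    NormedSpace.exp (logOp U κ r x ξ) = U x ξ + κ • (1 : X →L[ℂ] X) ∧
    IsUnit (1 - κ • NormedSpace.exp (-logOp U κ r x ξ)) ∧
    ∀ y : Y, ∃ g : X,
      HasWeakDerivWithinAt (fun z => logOp U κ r z ξ (J y)) g (Icc 0 L) x ∧
      (∀ g' : X, HasWeakDerivWithinAt (fun z => logOp U κ r z ξ (J y)) g' (Icc 0 L) x → g' = g) ∧
      A x (UY x ξ y) = NormedSpace.exp (logOp U κ r x ξ) g ∧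
      A x y = Ring.inverse (1 - κ • NormedSpace.exp (-logOp U κ r x ξ)) g ∧
      A x y = g + κ • U ξ x g ∧
      ∀ μ : ℝ, 0 < μ → ∀ φ : X →L[ℂ] ℂ, φ (U x ξ (J y)) ≠ 0 →
        DifferentiableWithinAt ℝ (fun z => φ (U z ξ (J y))) (Icc 0 L) x ∧
        coleHopf μ L (fun z => φ (U z ξ (J y))) x =
          ((-2 * (√μ)⁻¹ : ℝ) : ℂ) *
            (φ (NormedSpace.exp (logOp U κ r x ξ) g) * (φ (U x ξ (J y)))⁻¹) := by
  let _ : NormedAlgebra ℚ (X →L[ℂ] X) := NormedAlgebra.restrictScalars ℚ ℂ _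
  obtain ⟨hball, M, hM, hU⟩ := id hκ
  have hMκ : M < ‖κ‖ := hM.trans (lt_norm_of_closedBall_subset_slitPlane hball)
  have hexp : NormedSpace.exp (logOp U κ r x ξ) = U x ξ + κ • (1 : X →L[ℂ] X) :=
    exp_dunfordLog hball ((hU x hx ξ hξ).1.trans_lt hM)
  set E := NormedSpace.exp (-logOp U κ r x ξ) with hE
  have hE1 : (U x ξ + κ • (1 : X →L[ℂ] X)) * E = 1 := by
    rw [← hexp, hE, ← NormedSpace.exp_add_of_commute (Commute.refl _).neg_right, add_neg_cancel,
      NormedSpace.exp_zero]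
  have hE2 : E * (U x ξ + κ • (1 : X →L[ℂ] X)) = 1 := by
    rw [← hexp, hE, ← NormedSpace.exp_add_of_commute (Commute.refl (logOp U κ r x ξ)).neg_left, neg_add_cancel,
      NormedSpace.exp_zero]
  -- With E = (U + κ)⁻¹, I − κE = UE, whose inverse is (U + κ)U⁻¹ = I + κU(ξ,x).
  have hN1 : 1 - κ • E = U x ξ * E := by
    rw [← hE1, add_mul, smul_mul_assoc, one_mul, add_sub_cancel_right]
  have hN2 : 1 - κ • E = E * U x ξ := by
    rw [← hE2, mul_add, mul_smul_comm, mul_one, add_sub_cancel_right]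
  have hUinv : U x ξ * U ξ x = 1 := by rw [h.comp x hx ξ hξ x hx, h.refl x hx]
  have hUinv' : U ξ x * U x ξ = 1 := by rw [h.comp ξ hξ x hx ξ hξ, h.refl ξ hξ]
  have hI1 : (1 - κ • E) * (1 + κ • U ξ x) = 1 := by
    have : (1 + κ • U ξ x) = (U x ξ + κ • (1 : X →L[ℂ] X)) * U ξ x := by
      rw [add_mul, hUinv, smul_mul_assoc, one_mul]
    rw [hN1, this, mul_assoc, ← mul_assoc E, hE2, one_mul, hUinv]
  have hI2 : (1 + κ • U ξ x) * (1 - κ • E) = 1 := by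
    have : (1 + κ • U ξ x) = U ξ x * (U x ξ + κ • (1 : X →L[ℂ] X)) := by
      rw [mul_add, hUinv', mul_smul_comm, mul_one]
    have hcomm : (U x ξ + κ • (1 : X →L[ℂ] X)) * U x ξ = U x ξ * (U x ξ + κ • 1) := by
      rw [add_mul, mul_add, smul_mul_assoc, mul_smul_comm, one_mul, mul_one]
    rw [hN1, this, mul_assoc, ← mul_assoc _ (U x ξ) E, hcomm, mul_assoc, hE1, mul_one, hUinv']
  refine ⟨spectrum_add_smul_one_subset_ball ((hU x hx ξ hξ).1.trans_lt hM), hexp,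
    ⟨⟨_, _, hI1, hI2⟩, rfl⟩, fun y => ?_⟩
  set q := logQuotient κ (UY x ξ) (UY x ξ) y with hq
  have hqy : UY x ξ q + κ • q = y := logQuotient_self (hU x hx ξ hξ).2 hMκ y
  have hw := h.hasWeakDerivWithinAt_logOp hc hκ hx hξ y
  -- Substitute y = Uq + κq and move one factor U out of A(x).
  have hAy : A x (UY x ξ y) = NormedSpace.exp (logOp U κ r x ξ) (A x (UY x ξ q)) := by
    rw [hexp, ← hqy, map_add, map_add, hc x hx ξ hξ (UY x ξ q), map_smul, map_smul]
    rfl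
  have hA : A x y = A x (UY x ξ q) + κ • U ξ x (A x (UY x ξ q)) := by
    rw [hc x hx ξ hξ q, h.comp_apply hξ hx hξ, h.refl_apply hξ, ← hc x hx ξ hξ q, ← map_smul,
      ← map_add, hqy]
  refine ⟨A x (UY x ξ q), hw, fun g' hg' => hg'.unique hL hx hw, hAy, ?_, hA, ?_⟩
  · rw [ring_inverse_eq hI1 hI2, hA]
    rfl
  · intro μ _ φ _
    have h1 := h.hasWeakDerivWithinAt_orbit hx hξ y φ
    refine ⟨h1.differentiableWithinAt, ?_⟩
    rw [coleHopf, h1.derivWithin (uniqueDiffOn_Icc hL x hx), hAy]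

end LogarithmicRepresentation

/-! ### Multiplication families in a commutative Banach algebra -/

section BanachAlgebra

variable {B : Type*} [NormedCommRing B] [NormedAlgebra ℂ B]

/-- Multiplication by `u(x) u(ξ)⁻¹` in a commutative Banach algebra is an evolution family,
generated by multiplication by `u'(x) u(x)⁻¹`. -/
theorem isEvolutionFamily_mul [CompleteSpace B] {L : ℝ} {u u' : ℝ → B}
    (hu : ∀ x ∈ Icc 0 L, IsUnit (u x))
    (hd : ∀ x ∈ Icc 0 L, HasDerivWithinAt u (u' x) (Icc 0 L) x)
    {U : ℝ → ℝ → B →L[ℂ] B} {A : ℝ → B →ₗ[ℂ] B}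
    (hU : ∀ x ξ, U x ξ = ContinuousLinearMap.mul ℂ B (u x * Ring.inverse (u ξ)))
    (hA : ∀ x, A x = LinearMap.mulLeft ℂ (u' x * Ring.inverse (u x))) :
    IsEvolutionFamily L (ContinuousLinearMap.id ℂ B) U U A := by
  have hcont : ContinuousOn u (Icc 0 L) := fun x hx => (hd x hx).continuousWithinAt
  have hinv : ContinuousOn (fun x => Ring.inverse (u x)) (Icc 0 L) := fun x hx => by
    obtain ⟨v, hv⟩ := hu x hx
    have h1 : ContinuousAt Ring.inverse (u x) := hv ▸ NormedRing.inverse_continuousAt v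
    exact h1.comp_continuousWithinAt (hcont x hx)
  have happ : ∀ x ξ v, U x ξ v = u x * Ring.inverse (u ξ) * v := fun x ξ v => by rw [hU]; rfl
  have hco : ∀ s, ∀ v, ContinuousOn (fun t => U t s v) (Icc 0 L) := fun s v => by
    simp only [happ]
    exact (hcont.mul continuousOn_const).mul continuousOn_const
  have hbd : ∃ M, ∀ t ∈ Icc 0 L, ∀ s ∈ Icc 0 L, ‖U t s‖ ≤ M := by
    obtain ⟨C, hC⟩ := isCompact_Icc.exists_bound_of_continuousOn hcont
    obtain ⟨D, hD⟩ := isCompact_Icc.exists_bound_of_continuousOn hinv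
    refine ⟨C * D, fun t ht s hs => ?_⟩
    rw [hU]
    have hC0 : 0 ≤ C := (norm_nonneg _).trans (hC t ht)
    refine (ContinuousLinearMap.opNorm_mul_apply_le ℂ B _).trans ((norm_mul_le _ _).trans ?_)
    exact mul_le_mul (hC t ht) (hD s hs) (norm_nonneg _) hC0
  refine ⟨Function.injective_id, Function.surjective_id.denseRange, fun t _ r hr s _ => ?_,
    fun s hs => ?_, fun _ _ _ _ _ => rfl, fun s _ => hco s, fun s _ => hco s, ?_,
    fun x hx y φ => ?_⟩
  · ext v
    simp only [mul_apply_eq_comp, happ]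
    have h1 := Ring.inverse_mul_cancel _ (hu r hr)
    linear_combination (u t * Ring.inverse (u s) * v) * h1
  · ext v
    simp only [one_apply_eq_self, happ, Ring.mul_inverse_cancel _ (hu s hs), one_mul]
  · obtain ⟨M, hM⟩ := hbd
    -- Compactness of [0, L] gives a uniform bound, so β = 0 suffices.
    exact ⟨M, 0, fun t ht s hs => by simpa using hM t ht s hs⟩
  · have h1 : HasDerivWithinAt (fun z => U z x y) (A x y) (Icc 0 L) x := by
      simp only [happ, hA]
      exact ((hd x hx).mul_const _).mul_const _
    exact (φ.restrictScalars ℝ).hasFDerivAt.comp_hasDerivWithinAt x h1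

theorem commutes_mul {L : ℝ} {u u' : ℝ → B}
    {U : ℝ → ℝ → B →L[ℂ] B} {A : ℝ → B →ₗ[ℂ] B}
    (hU : ∀ x ξ, U x ξ = ContinuousLinearMap.mul ℂ B (u x * Ring.inverse (u ξ)))
    (hA : ∀ x, A x = LinearMap.mulLeft ℂ (u' x * Ring.inverse (u x))) :
    Commutes L U U A := by
  intro x _ ξ _ y
  rw [hU, hA]
  exact mul_left_comm _ _ _

end BanachAlgebra

/-! ### Bounded Fourier multipliers and dominated convergence in L² -/

section Multiplier

/-- Measurable bounded functions, the symbols of bounded Fourier multipliers. -/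
def IsBoundedSymbol (b : ℝ → ℂ) : Prop := Measurable b ∧ ∃ C : ℝ, ∀ w, ‖b w‖ ≤ C

theorem IsBoundedSymbol.memLp_mul {b : ℝ → ℂ} (hb : IsBoundedSymbol b) (f : L2) :
    MemLp (fun w => b w * f w) 2 volume := by
  obtain ⟨hm, C, hC⟩ := hb
  refine (Lp.memLp f).of_le_mul (c := C)
    (hm.aestronglyMeasurable.mul (Lp.aestronglyMeasurable f)) (Eventually.of_forall fun w => ?_)
  rw [norm_mul]
  gcongr
  exact hC w

/-- Multiplication by a bounded symbol in `L²`. -/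
noncomputable def mulOp {b : ℝ → ℂ} (hb : IsBoundedSymbol b) : L2 →L[ℂ] L2 :=
  LinearMap.mkContinuous
    { toFun := fun f => (hb.memLp_mul f).toLp _
      map_add' := fun f g => by
        rw [← MemLp.toLp_add]
        refine MemLp.toLp_congr _ _ ?_
        filter_upwards [Lp.coeFn_add f g] with w hw
        change b w * (f + g : L2) w = b w * f w + b w * g w
        rw [hw, Pi.add_apply, mul_add]
      map_smul' := fun c f => by
        rw [RingHom.id_apply, ← MemLp.toLp_const_smul]
        refine MemLp.toLp_congr _ _ ?_
        filter_upwards [Lp.coeFn_smul c f] with w hw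
        change b w * (c • f : L2) w = c • (b w * f w)
        rw [hw, Pi.smul_apply, smul_eq_mul, smul_eq_mul, mul_left_comm] }
    hb.2.choose (fun f => by
      refine Lp.norm_le_mul_norm_of_ae_le_mul ?_
      filter_upwards [(hb.memLp_mul f).coeFn_toLp] with w hw
      simp only [LinearMap.coe_mk, AddHom.coe_mk]
      rw [hw, norm_mul]
      gcongr
      exact hb.2.choose_spec w)

theorem mulOp_coe {b : ℝ → ℂ} (hb : IsBoundedSymbol b) (f : L2) :
    mulOp hb f =ᵐ[volume] fun w => b w * f w :=
  (hb.memLp_mul f).coeFn_toLp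

open scoped Classical in
/-- The Fourier multiplier in `L²` with a bounded symbol. -/
noncomputable def fourierMul (b : ℝ → ℂ) : L2 →L[ℂ] L2 :=
  if hb : IsBoundedSymbol b then
    ((Lp.fourierTransformₗᵢ ℝ ℂ).symm.toContinuousLinearEquiv : L2 →L[ℂ] L2) ∘L mulOp hb ∘L
      ((Lp.fourierTransformₗᵢ ℝ ℂ).toContinuousLinearEquiv : L2 →L[ℂ] L2)
  else 0

/-- The hypothesis on b selects the genuine multiplier; otherwise `fourierMul` has the default value
0. -/
theorem fourier_fourierMul {b : ℝ → ℂ} (hb : IsBoundedSymbol b) (f : L2) :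
    (𝓕 (fourierMul b f) : L2) =ᵐ[volume] fun w => b w * (𝓕 f : L2) w := by
  have h1 : (𝓕 (fourierMul b f) : L2) = mulOp hb (𝓕 f) := by
    rw [fourierMul, dif_pos hb]
    exact (Lp.fourierTransformₗᵢ ℝ ℂ).apply_symm_apply _
  rw [h1]
  exact mulOp_coe hb _

theorem eq_of_fourier_ae_eq {f g : L2} (h : (𝓕 f : L2) =ᵐ[volume] (𝓕 g : L2)) : f = g :=
  (Lp.fourierTransformₗᵢ ℝ ℂ).injective (Lp.ext h)

theorem fourier_sub_coe (f g : L2) :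
    (𝓕 (f - g) : L2) =ᵐ[volume] fun w => (𝓕 f : L2) w - (𝓕 g : L2) w := by
  rw [show (𝓕 (f - g) : L2) = 𝓕 f - 𝓕 g from (Lp.fourierTransformₗᵢ ℝ ℂ).map_sub f g]
  exact Lp.coeFn_sub _ _

theorem fourier_smul_coe (c : ℂ) (f : L2) :
    (𝓕 (c • f) : L2) =ᵐ[volume] fun w => c * (𝓕 f : L2) w := by
  rw [show (𝓕 (c • f) : L2) = c • 𝓕 f from (Lp.fourierTransformₗᵢ ℝ ℂ).map_smul c f]
  exact Lp.coeFn_smul _ _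

/-- Dominated convergence in `L²`. -/
theorem tendsto_L2_of_dominated {ι : Type*} {l : Filter ι} [l.IsCountablyGenerated]
    {G : ι → L2} {G₀ h : L2} {g : ι → ℝ → ℂ} {g₀ : ℝ → ℂ}
    (hG : ∀ᶠ i in l, G i =ᵐ[volume] g i) (hG₀ : G₀ =ᵐ[volume] g₀)
    (hg : ∀ᵐ w, Tendsto (fun i => g i w) l (𝓝 (g₀ w)))
    (hb : ∀ᶠ i in l, ∀ᵐ w, ‖g i w‖ ≤ ‖h w‖) : Tendsto G l (𝓝 G₀) := by
  rw [Lp.tendsto_Lp_iff_tendsto_eLpNorm']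
  have h2 : ∀ F : ℝ → ℂ, eLpNorm F 2 volume = (∫⁻ w, ‖F w‖ₑ ^ (2 : ℝ)) ^ (1 / 2 : ℝ) := fun F => by
    rw [eLpNorm_eq_lintegral_rpow_enorm_toReal (by norm_num) (by norm_num)]
    simp
  have hfin : ∫⁻ w, (‖h w‖ₑ + ‖G₀ w‖ₑ) ^ (2 : ℝ) ≠ ⊤ := by
    have h3 : MemLp (fun w => ‖h w‖ + ‖G₀ w‖) 2 volume := (Lp.memLp h).norm.add (Lp.memLp G₀).norm
    have h4 := lintegral_rpow_enorm_lt_top_of_eLpNorm_lt_top (by norm_num) (by norm_num) h3.2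
    refine ne_of_lt (lt_of_le_of_lt (le_of_eq ?_) h4)
    refine lintegral_congr fun w => ?_
    rw [Real.enorm_eq_ofReal (by positivity), ENNReal.ofReal_add (norm_nonneg _) (norm_nonneg _),
      ofReal_norm, ofReal_norm]
    simp
  have key : Tendsto (fun i => ∫⁻ w, ‖G i w - G₀ w‖ₑ ^ (2 : ℝ)) l (𝓝 0) := by
    have h5 : Tendsto (fun i => ∫⁻ w, ‖g i w - g₀ w‖ₑ ^ (2 : ℝ)) l (𝓝 (∫⁻ _ : ℝ, 0)) := by
      refine tendsto_lintegral_filter_of_dominated_convergence'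
        (fun w => (‖h w‖ₑ + ‖G₀ w‖ₑ) ^ (2 : ℝ)) ?_ ?_ hfin ?_
      · filter_upwards [hG] with i hi
        have h6 : AEStronglyMeasurable (fun w => g i w - g₀ w) volume :=
          ((Lp.aestronglyMeasurable (G i)).congr hi).sub ((Lp.aestronglyMeasurable G₀).congr hG₀)
        exact h6.enorm.pow_const _
      · filter_upwards [hb] with i hi
        filter_upwards [hi, hG₀] with w h6 h7
        gcongr
        rw [h7]
        refine enorm_sub_le.trans ?_
        gcongr
        exact enorm_le_iff_norm_le.2 h6
      · filter_upwards [hg] with w hw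
        have h6 : Tendsto (fun i => ‖g i w - g₀ w‖ₑ ^ (2 : ℝ)) l (𝓝 (‖g₀ w - g₀ w‖ₑ ^ (2 : ℝ))) :=
          ((hw.sub_const (g₀ w)).enorm).ennrpow_const _
        simpa using h6
    rw [lintegral_zero] at h5
    refine h5.congr' ?_
    filter_upwards [hG] with i hi
    refine lintegral_congr_ae ?_
    filter_upwards [hi, hG₀] with w h6 h7
    rw [h6, h7]
  have h8 := key.ennrpow_const (1 / 2 : ℝ)
  rw [ENNReal.zero_rpow_of_pos (by norm_num)] at h8
  simpa only [h2, Pi.sub_apply] using h8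

theorem tendsto_of_fourier {ι : Type*} {l : Filter ι} {G : ι → L2} {G₀ : L2}
    (h : Tendsto (fun i => (𝓕 (G i) : L2)) l (𝓝 (𝓕 G₀))) : Tendsto G l (𝓝 G₀) :=
  (Lp.fourierTransformₗᵢ ℝ ℂ).toHomeomorph.isInducing.tendsto_nhds_iff.2 h

/-- Dominated convergence for Fourier multipliers. -/
theorem tendsto_of_multiplier {ι : Type*} {l : Filter ι} [l.IsCountablyGenerated]
    {G : ι → L2} {G₀ f h : L2} {b : ι → ℝ → ℂ} {b₀ : ℝ → ℂ}
    (hG : ∀ᶠ i in l, (𝓕 (G i) : L2) =ᵐ[volume] fun w => b i w * (𝓕 f : L2) w)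
    (hG₀ : (𝓕 G₀ : L2) =ᵐ[volume] fun w => b₀ w * (𝓕 f : L2) w)
    (hb : ∀ w, Tendsto (fun i => b i w) l (𝓝 (b₀ w)))
    (hh : ∀ᶠ i in l, ∀ᵐ w, ‖b i w * (𝓕 f : L2) w‖ ≤ ‖h w‖) : Tendsto G l (𝓝 G₀) :=
  tendsto_of_fourier <| tendsto_L2_of_dominated hG hG₀
    (Eventually.of_forall fun w => (hb w).mul_const _) hh

/-- A Lipschitz bound at x, uniform in the frequency, makes C·𝓕f dominate all difference quotients.
-/
theorem hasDerivAt_of_multiplier {G : ℝ → L2} {G' f : L2} {b : ℝ → ℝ → ℂ} {b' : ℝ → ℂ} {x C : ℝ}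
    (hG : ∀ᶠ z in 𝓝 x, (𝓕 (G z) : L2) =ᵐ[volume] fun w => b z w * (𝓕 f : L2) w)
    (hG' : (𝓕 G' : L2) =ᵐ[volume] fun w => b' w * (𝓕 f : L2) w)
    (hb : ∀ w, HasDerivAt (fun z => b z w) (b' w) x)
    (hC : ∀ᶠ z in 𝓝 x, ∀ w, ‖b z w - b x w‖ ≤ C * |z - x|) : HasDerivAt G G' x := by
  rw [hasDerivAt_iff_tendsto_slope]
  refine tendsto_of_multiplier (f := f) (h := (C : ℂ) • (𝓕 f : L2))
    (b := fun z w => ((z - x)⁻¹ : ℝ) * (b z w - b x w)) ?_ hG' (fun w => ?_) ?_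
  · filter_upwards [hG.filter_mono nhdsWithin_le_nhds] with z hz
    rw [slope_def_module, show (z - x)⁻¹ • (G z - G x) = (((z - x)⁻¹ : ℝ) : ℂ) • (G z - G x) from
      (Complex.coe_smul _ _).symm]
    filter_upwards [hz, hG.self_of_nhds, fourier_smul_coe (((z - x)⁻¹ : ℝ) : ℂ) (G z - G x),
      fourier_sub_coe (G z) (G x)] with w h1 h2 h3 h4
    rw [h3, h4, h1, h2]; ring
  · refine (hasDerivAt_iff_tendsto_slope.1 (hb w)).congr fun z => ?_
    rw [slope_def_module, Complex.real_smul]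
  · filter_upwards [hC.filter_mono nhdsWithin_le_nhds, self_mem_nhdsWithin] with z hz hzx
    filter_upwards [Lp.coeFn_smul (C : ℂ) (𝓕 f : L2)] with w hw
    rw [hw, Pi.smul_apply, smul_eq_mul, norm_mul, norm_mul, norm_mul, Complex.norm_real,
      Complex.norm_real]
    gcongr
    have h0 : 0 < |z - x| := abs_pos.2 (sub_ne_zero.2 hzx)
    rw [norm_inv, Real.norm_eq_abs, inv_mul_le_iff₀ h0, mul_comm]
    exact (hz w).trans (by gcongr; exact le_abs_self C)

end Multiplier

/-! ### Contraction semigroups with multiplier generators -/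

section MultiplierSemigroup

/-- Mean value inequality on the convex half-plane Re z ≤ a, where the derivative has norm at most
e^a. -/
theorem norm_exp_sub_exp_le {u v : ℂ} {a : ℝ} (hu : u.re ≤ a) (hv : v.re ≤ a) :
    ‖Complex.exp u - Complex.exp v‖ ≤ Real.exp a * ‖u - v‖ := by
  have hs : Convex ℝ {z : ℂ | z.re ≤ a} := convex_halfSpace_re_le a
  refine hs.norm_image_sub_le_of_norm_hasDerivWithin_le (f' := Complex.exp)
    (fun z _ => (Complex.hasDerivAt_exp z).hasDerivWithinAt) (fun z hz => ?_) hv hu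
  rw [Complex.norm_exp]
  exact Real.exp_le_exp.2 hz

theorem isBoundedSymbol_exp {m : ℝ → ℂ} (hm : Measurable m) (hre : ∀ w, (m w).re ≤ 0) {t : ℝ}
    (ht : 0 ≤ t) : IsBoundedSymbol fun w => Complex.exp (t * m w) := by
  refine ⟨Complex.measurable_exp.comp (measurable_const.mul hm), 1, fun w => ?_⟩
  rw [Complex.norm_exp, Real.exp_le_one_iff, Complex.re_ofReal_mul]
  exact mul_nonpos_of_nonneg_of_nonpos ht (hre w)

/-- The semigroup `exp (t m)` of Fourier multipliers, extended evenly to negative times. -/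
noncomputable def multiplierSemigroup (m : ℝ → ℂ) (t : ℝ) : L2 →L[ℂ] L2 :=
  fourierMul fun w => Complex.exp ((|t| : ℝ) * m w)

variable {m : ℝ → ℂ}

theorem fourier_multiplierSemigroup (hm : Measurable m) (hre : ∀ w, (m w).re ≤ 0) (t : ℝ)
    (f : L2) : (𝓕 (multiplierSemigroup m t f) : L2) =ᵐ[volume]
      fun w => Complex.exp ((|t| : ℝ) * m w) * (𝓕 f : L2) w :=
  fourier_fourierMul (isBoundedSymbol_exp hm hre (abs_nonneg t)) f

theorem norm_multiplierSemigroup_le (hm : Measurable m) (hre : ∀ w, (m w).re ≤ 0) (t : ℝ)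
    (f : L2) : ‖multiplierSemigroup m t f‖ ≤ ‖f‖ := by
  rw [← Lp.norm_fourier_eq (multiplierSemigroup m t f), ← Lp.norm_fourier_eq f]
  refine Lp.norm_le_norm_of_ae_le ?_
  filter_upwards [fourier_multiplierSemigroup hm hre t f] with w hw
  rw [hw, norm_mul, Complex.norm_exp, Complex.re_ofReal_mul]
  exact mul_le_of_le_one_left (norm_nonneg _) (Real.exp_le_one_iff.2
    (mul_nonpos_of_nonneg_of_nonpos (abs_nonneg t) (hre w)))

theorem isC0Semigroup_multiplierSemigroup (hm : Measurable m) (hre : ∀ w, (m w).re ≤ 0) :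
    IsC0Semigroup (multiplierSemigroup m) := by
  refine ⟨?_, fun s t hs ht => ?_, fun f => ?_⟩
  · ext1 f
    refine eq_of_fourier_ae_eq ?_
    filter_upwards [fourier_multiplierSemigroup hm hre 0 f] with w hw
    rw [hw]; simp
  · ext1 f
    refine eq_of_fourier_ae_eq ?_
    filter_upwards [fourier_multiplierSemigroup hm hre (s + t) f,
      fourier_multiplierSemigroup hm hre s (multiplierSemigroup m t f),
      fourier_multiplierSemigroup hm hre t f] with w h1 h2 h3
    rw [h1, mul_apply_eq_comp, h2, h3, abs_of_nonneg hs, abs_of_nonneg ht,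
      abs_of_nonneg (add_nonneg hs ht), ← mul_assoc, ← Complex.exp_add, ← add_mul,
      Complex.ofReal_add]
  · refine Continuous.continuousOn (continuous_iff_continuousAt.2 fun t => ?_)
    refine tendsto_of_multiplier (f := f) (h := (𝓕 f : L2))
      (b := fun s w => Complex.exp ((|s| : ℝ) * m w))
      (Eventually.of_forall fun s => fourier_multiplierSemigroup hm hre s f)
      (fourier_multiplierSemigroup hm hre t f) (fun w => ?_)
      (Eventually.of_forall fun s => Eventually.of_forall fun w => ?_)
    · exact Continuous.tendsto (by fun_prop) t
    · rw [norm_mul, Complex.norm_exp, Complex.re_ofReal_mul]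
      exact mul_le_of_le_one_left (norm_nonneg _) (Real.exp_le_one_iff.2
        (mul_nonpos_of_nonneg_of_nonpos (abs_nonneg s) (hre w)))

/-- Forward: |e^{hm} − 1| ≤ h|m| for Re m ≤ 0, so |m 𝓕f| = |𝓕g| dominates. Backward: L² convergence
yields an a.e. convergent subsequence, whose pointwise limit must be m 𝓕f. Hence the generator has
exactly the maximal domain. -/
theorem tendsto_multiplierSemigroup_slope_iff (hm : Measurable m) (hre : ∀ w, (m w).re ≤ 0)
    (f g : L2) : (f, g) ∈ multiplierGraph m ↔
      Tendsto (fun h : ℝ => ((h⁻¹ : ℝ) : ℂ) • (multiplierSemigroup m h f - f)) (𝓝[>] 0) (𝓝 g) := by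
  have hS : ∀ h : ℝ, (𝓕 (((h⁻¹ : ℝ) : ℂ) • (multiplierSemigroup m h f - f)) : L2) =ᵐ[volume]
      fun w => ((h⁻¹ : ℝ) : ℂ) * (Complex.exp ((|h| : ℝ) * m w) - 1) * (𝓕 f : L2) w := fun h => by
    filter_upwards [fourier_smul_coe ((h⁻¹ : ℝ) : ℂ) (multiplierSemigroup m h f - f),
      fourier_sub_coe (multiplierSemigroup m h f) f, fourier_multiplierSemigroup hm hre h f]
      with w h1 h2 h3
    rw [h1, h2, h3]; ring
  have hlim : ∀ w, Tendsto (fun h : ℝ => ((h⁻¹ : ℝ) : ℂ) * (Complex.exp ((|h| : ℝ) * m w) - 1))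
      (𝓝[>] 0) (𝓝 (m w)) := fun w => by
    have h1 : HasDerivAt (fun h : ℝ => Complex.exp (h * m w)) (m w) 0 := by
      have := (((hasDerivAt_id (0 : ℝ)).ofReal_comp).mul_const (m w)).cexp
      simpa using this
    have h2 := h1.hasDerivWithinAt (s := Ioi 0)
    rw [hasDerivWithinAt_iff_tendsto_slope' self_notMem_Ioi] at h2
    refine h2.congr' ?_
    filter_upwards [self_mem_nhdsWithin] with h hh
    rw [slope_def_module, abs_of_pos hh, Complex.real_smul]
    simp
  constructor
  · intro hfg
    have hfg' : (𝓕 g : L2) =ᵐ[volume] fun w => m w * (𝓕 f : L2) w := hfg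
    refine tendsto_of_multiplier (f := f) (h := (𝓕 g : L2)) (Eventually.of_forall hS) hfg' hlim ?_
    filter_upwards [self_mem_nhdsWithin] with h hh
    filter_upwards [hfg'] with w hw
    have hh : 0 < h := hh
    rw [hw, norm_mul, norm_mul (m w)]
    refine mul_le_mul_of_nonneg_right ?_ (norm_nonneg _)
    rw [norm_mul, Complex.norm_real, abs_of_pos hh, norm_inv, Real.norm_eq_abs, abs_of_pos hh,
      inv_mul_le_iff₀ hh]
    have h1 := norm_exp_sub_exp_le (u := (h : ℂ) * m w) (v := 0) (a := 0)
      (by rw [Complex.re_ofReal_mul]; exact mul_nonpos_of_nonneg_of_nonpos hh.le (hre w))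
      (by simp)
    rw [Complex.exp_zero, Real.exp_zero, one_mul, sub_zero, norm_mul, Complex.norm_real,
      Real.norm_eq_abs, abs_of_pos hh] at h1
    exact h1
  · intro h
    have h1 := ((Lp.fourierTransformₗᵢ ℝ ℂ).continuous.tendsto g).comp h
    obtain ⟨ns, hns, hae⟩ := (tendstoInMeasure_of_tendsto_Lp h1).exists_seq_tendsto_ae'
    have h2 : ∀ᵐ w, ∀ i : ℕ, (𝓕 (((((ns i)⁻¹ : ℝ)) : ℂ) • (multiplierSemigroup m (ns i) f - f))
        : L2) w = (((ns i)⁻¹ : ℝ) : ℂ) * (Complex.exp ((|ns i| : ℝ) * m w) - 1) * (𝓕 f : L2) w :=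
      ae_all_iff.2 fun i => hS (ns i)
    change (𝓕 g : L2) =ᵐ[volume] fun w => m w * (𝓕 f : L2) w
    filter_upwards [hae, h2] with w h3 h4
    refine tendsto_nhds_unique h3 ?_
    refine (((hlim w).comp hns).mul_const ((𝓕 f : L2) w)).congr fun i => ?_
    exact (h4 i).symm

theorem isGenerator_multiplierSemigroup (hm : Measurable m) (hre : ∀ w, (m w).re ≤ 0)
    {A : L2 →ₗ.[ℂ] L2} (hA : A.graph = multiplierGraph m) :
    IsGenerator A (multiplierSemigroup m) := fun f g => by
  rw [hA]
  exact tendsto_multiplierSemigroup_slope_iff hm hre f g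

end MultiplierSemigroup

/-! ### The symbol of the fractional power -/

section FractionalPower

/-- The symbol of `(c ∂_t)^α`. -/
noncomputable def fracSymbol (c α : ℝ) (w : ℝ) : ℂ :=
  (2 * Real.pi * Complex.I * c * w : ℂ) ^ (α : ℂ)

theorem measurable_fracSymbol (c α : ℝ) : Measurable (fracSymbol c α) := by
  unfold fracSymbol
  exact (measurable_const.mul Complex.measurable_ofReal).pow_const _

theorem fracPow_neg_graph (c α : ℝ) :
    (-fracPow c α).graph = multiplierGraph fun w => -fracSymbol c α w := by
  ext ⟨f, g⟩
  have h1 : (f, g) ∈ (-fracPow c α).graph ↔ (f, -g) ∈ (fracPow c α).graph := by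
    rw [LinearPMap.neg_graph, Submodule.mem_map]
    constructor
    · rintro ⟨⟨a, b⟩, hab, h⟩
      simp only [LinearMap.prodMap_apply, LinearMap.id_coe, id, LinearMap.neg_apply,
        Prod.mk_inj] at h
      rw [← h.1, ← h.2, neg_neg]
      exact hab
    · intro h
      exact ⟨(f, -g), h, by simp⟩
  rw [h1, fracPow_graph]
  have h2 : (𝓕 (-g) : L2) = -𝓕 g := (Lp.fourierTransformₗᵢ ℝ ℂ).map_neg g
  change (𝓕 (-g) : L2) =ᵐ[volume] (fun w => fracSymbol c α w * (𝓕 f : L2) w) ↔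
    (𝓕 g : L2) =ᵐ[volume] fun w => -fracSymbol c α w * (𝓕 f : L2) w
  rw [h2]
  constructor <;> intro h <;> filter_upwards [h, Lp.coeFn_neg (𝓕 g : L2)] with w h3 h4
  · rw [h4, Pi.neg_apply] at h3
    rw [neg_mul, ← h3, neg_neg]
  · rw [h4, Pi.neg_apply, h3, neg_mul, neg_neg]

/-- The symbol lies in the sector of half-angle `απ/2`. -/
theorem fracSymbol_re {c : ℝ} (hc : 0 < c) {α : ℝ} (hα : 0 < α) (w : ℝ) :
    (fracSymbol c α w).re = ‖fracSymbol c α w‖ * Real.cos (α * (Real.pi / 2)) := by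
  rcases eq_or_ne w 0 with rfl | hw
  · simp [fracSymbol, hα.ne']
  have hz : (2 * Real.pi * Complex.I * c * w : ℂ) = ((2 * Real.pi * c * w : ℝ) : ℂ) * Complex.I := by
    push_cast; ring
  have hz0 : (2 * Real.pi * Complex.I * c * w : ℂ) ≠ 0 := by
    simp [hw, hc.ne', Real.pi_ne_zero]
  set z : ℂ := 2 * Real.pi * Complex.I * c * w with hzdef
  have h1 : fracSymbol c α w = Complex.exp (Complex.log z * α) := by
    rw [fracSymbol, Complex.cpow_def_of_ne_zero hz0]
  have h2 : (Complex.log z * α).im = z.arg * α := by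
    rw [Complex.im_mul_ofReal, Complex.log_im]
  rw [h1, Complex.exp_re, Complex.norm_exp, h2]
  congr 1
  -- The base is purely imaginary, so its argument is ±π/2; the sign disappears because cosine is
  -- even.
  rcases lt_or_gt_of_ne hw with hw | hw
  · have h3 : z.arg = -(Real.pi / 2) := by
      rw [Complex.arg_eq_neg_pi_div_two_iff, hz]
      simp only [Complex.re_ofReal_mul, Complex.I_re, mul_zero, Complex.im_ofReal_mul,
        Complex.I_im, mul_one, true_and]
      exact mul_neg_of_pos_of_neg (by positivity) hw
    rw [h3, neg_mul, Real.cos_neg, mul_comm]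
  · have h3 : z.arg = Real.pi / 2 := by
      rw [Complex.arg_eq_pi_div_two_iff, hz]
      simp only [Complex.re_ofReal_mul, Complex.I_re, mul_zero, Complex.im_ofReal_mul,
        Complex.I_im, mul_one, true_and]
      positivity
    rw [h3, mul_comm]

theorem neg_fracSymbol_re_nonpos {c : ℝ} (hc : 0 < c) {α : ℝ} (hα : 0 < α) (hα1 : α < 1) (w : ℝ) :
    (-fracSymbol c α w).re ≤ 0 := by
  rw [Complex.neg_re, fracSymbol_re hc hα, neg_nonpos]
  have := Real.pi_pos
  exact mul_nonneg (norm_nonneg _) (Real.cos_nonneg_of_mem_Icc ⟨by nlinarith, by nlinarith⟩)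

theorem fracSymbol_half_sq (c w : ℝ) :
    fracSymbol c (1 / 2) w * fracSymbol c (1 / 2) w = 2 * Real.pi * Complex.I * c * w := by
  rw [fracSymbol, ← sq]
  have h : (((1 / 2 : ℝ)) : ℂ) = ((2 : ℕ) : ℂ)⁻¹ := by push_cast; norm_num
  rw [h, Complex.cpow_nat_inv_pow _ two_ne_zero]

end FractionalPower

/-! ### Translations as Fourier multipliers -/

section Translation

/-- Translation by `a` in `L²`. -/
noncomputable def translation (a : ℝ) : L2 →L[ℂ] L2 :=
  (Lp.compMeasurePreservingₗᵢ ℂ (fun t : ℝ => t + a)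
    (measurePreserving_add_right volume a)).toContinuousLinearMap

theorem translation_coe (a : ℝ) (f : L2) : translation a f =ᵐ[volume] fun t => f (t + a) :=
  Lp.coeFn_compMeasurePreserving f (measurePreserving_add_right volume a)

theorem norm_translation (a : ℝ) (f : L2) : ‖translation a f‖ = ‖f‖ :=
  Lp.norm_compMeasurePreserving f (measurePreserving_add_right volume a)

/-- The symbol of translation by `a`. -/
noncomputable def translationSymbol (a w : ℝ) : ℂ := Complex.exp (2 * Real.pi * Complex.I * a * w)

theorem norm_translationSymbol (a w : ℝ) : ‖translationSymbol a w‖ = 1 := by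
  rw [translationSymbol, show (2 * Real.pi * Complex.I * a * w : ℂ) =
    ((2 * Real.pi * a * w : ℝ) : ℂ) * Complex.I by push_cast; ring, Complex.norm_exp_ofReal_mul_I]

theorem isBoundedSymbol_translationSymbol (a : ℝ) : IsBoundedSymbol (translationSymbol a) :=
  ⟨by unfold translationSymbol; fun_prop, 1, fun w => (norm_translationSymbol a w).le⟩

theorem fourier_comp_add_right (f : ℝ → ℂ) (a w : ℝ) :
    𝓕 (fun t => f (t + a)) w = translationSymbol a w * 𝓕 f w := by
  rw [Real.fourier_real_eq_integral_exp_smul, Real.fourier_real_eq_integral_exp_smul,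
    ← integral_const_mul,
    ← integral_add_right_eq_self (fun t => translationSymbol a w * _) a]
  refine integral_congr_ae (Eventually.of_forall fun t => ?_)
  simp only [translationSymbol, smul_eq_mul]
  rw [← mul_assoc, ← Complex.exp_add]
  congr 2
  push_cast
  ring

/-- Both sides are bounded, so it suffices to compare them on the dense Schwartz functions, where
the Fourier transform is an integral. -/
theorem translation_eq_fourierMul (a : ℝ) : translation a = fourierMul (translationSymbol a) := by
  have hd := SchwartzMap.denseRange_toLpCLM (E := ℝ) (F := ℂ) (p := 2)
    (μ := (volume : Measure ℝ)) ENNReal.ofNat_ne_top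
  refine ContinuousLinearMap.ext fun f => congrFun (hd.equalizer (translation a).continuous
    (fourierMul (translationSymbol a)).continuous (funext fun φ => ?_)) f
  have h1 : translation a (φ.toLp 2) = (φ.compSubConstCLM ℂ (-a)).toLp 2 := by
    refine Lp.ext ?_
    have h2 := (measurePreserving_add_right (volume : Measure ℝ) a).quasiMeasurePreserving.ae
      (φ.coeFn_toLp 2 volume)
    filter_upwards [translation_coe a (φ.toLp 2), (φ.compSubConstCLM ℂ (-a)).coeFn_toLp 2 volume, h2]
      with t h3 h4 h5
    rw [h3, h4, h5, SchwartzMap.compSubConstCLM_apply, sub_neg_eq_add]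
  have h6 : translation a (φ.toLp 2) = fourierMul (translationSymbol a) (φ.toLp 2) := by
    refine eq_of_fourier_ae_eq ?_
    have h7 := fourier_fourierMul (isBoundedSymbol_translationSymbol a) (φ.toLp 2)
    rw [h1, SchwartzMap.toLp_fourier_eq]
    rw [SchwartzMap.toLp_fourier_eq] at h7
    filter_upwards [h7, (𝓕 φ).coeFn_toLp 2 volume,
      (𝓕 (φ.compSubConstCLM ℂ (-a))).coeFn_toLp 2 volume] with w h8 h9 h10
    rw [h8, h9, h10, SchwartzMap.fourier_coe, SchwartzMap.fourier_coe, ← fourier_comp_add_right]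
    refine congrArg (fun F : ℝ → ℂ => 𝓕 F w) (funext fun t => ?_)
    simp
  exact h6

theorem fourier_translation (a : ℝ) (f : L2) :
    (𝓕 (translation a f) : L2) =ᵐ[volume] fun w => translationSymbol a w * (𝓕 f : L2) w := by
  rw [translation_eq_fourierMul]
  exact fourier_fourierMul (isBoundedSymbol_translationSymbol a) f

theorem translation_add (a b : ℝ) : translation (a + b) = translation a * translation b := by
  ext1 f
  refine eq_of_fourier_ae_eq ?_
  filter_upwards [fourier_translation (a + b) f, fourier_translation a (translation b f),
    fourier_translation b f] with w h1 h2 h3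
  rw [h1, mul_apply_eq_comp, h2, h3, ← mul_assoc]
  simp only [translationSymbol]
  rw [← Complex.exp_add]
  congr 2
  push_cast
  ring

theorem continuous_translation (f : L2) : Continuous fun a => translation a f := by
  refine continuous_iff_continuousAt.2 fun a => ?_
  refine tendsto_of_multiplier (f := f) (h := (𝓕 f : L2)) (b := fun a w => translationSymbol a w)
    (Eventually.of_forall fun s => fourier_translation s f)
    (fourier_translation a f) (fun w => ?_)
    (Eventually.of_forall fun s => Eventually.of_forall fun w => ?_)
  · unfold translationSymbol
    exact Continuous.tendsto (by fun_prop) a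
  · rw [norm_mul, norm_translationSymbol, one_mul]

theorem translation_zero : translation 0 = 1 := by
  ext1 f
  refine eq_of_fourier_ae_eq ?_
  filter_upwards [fourier_translation 0 f] with w h1
  rw [h1]
  simp [translationSymbol]

/-- The symbol of `c ∂_t`. -/
noncomputable def ddtSymbol (c w : ℝ) : ℂ := 2 * Real.pi * Complex.I * c * w

theorem measurable_ddtSymbol (c : ℝ) : Measurable (ddtSymbol c) := by
  unfold ddtSymbol; fun_prop

theorem ddtSymbol_re (c w : ℝ) : (ddtSymbol c w).re = 0 := by
  rw [ddtSymbol, show (2 * Real.pi * Complex.I * c * w : ℂ) =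
    ((2 * Real.pi * c * w : ℝ) : ℂ) * Complex.I by push_cast; ring, Complex.re_ofReal_mul,
    Complex.I_re, mul_zero]

/-- Restricted to h ≥ 0 because `multiplierSemigroup` is even in time while translations form a
group. -/
theorem multiplierSemigroup_ddtSymbol (c : ℝ) {h : ℝ} (hh : 0 ≤ h) :
    multiplierSemigroup (ddtSymbol c) h = translation (c * h) := by
  rw [translation_eq_fourierMul, multiplierSemigroup, abs_of_nonneg hh]
  congr 1
  ext w
  rw [translationSymbol, ddtSymbol]
  congr 1
  push_cast
  ring

end Translation

/-! ### The weak derivative on H¹ as a multiplier -/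

section WeakDerivative

theorem memLp_test {φ : ℝ → ℝ} (hφ : Continuous φ) (hs : HasCompactSupport φ) :
    MemLp (fun t => (φ t : ℂ)) 2 (volume : Measure ℝ) :=
  (Complex.continuous_ofReal.comp hφ).memLp_of_hasCompactSupport
    (hs.comp_left Complex.ofReal_zero)

theorem integral_test_smul_eq_inner {φ : ℝ → ℝ} (hφ : Continuous φ) (hs : HasCompactSupport φ)
    (f : L2) : ∫ t, φ t • f t = inner ℂ ((memLp_test hφ hs).toLp _) f := by
  rw [L2.inner_def]
  refine integral_congr_ae ?_
  filter_upwards [(memLp_test hφ hs).coeFn_toLp] with t ht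
  rw [ht, RCLike.inner_apply, Complex.conj_ofReal, Complex.real_smul, mul_comm]

theorem integral_test_smul_translation (φ : ℝ → ℝ) (a : ℝ) (f : L2) :
    ∫ t, φ t • translation a f t = ∫ t, φ (t - a) • f t := by
  rw [← integral_add_right_eq_self (fun t => φ (t - a) • f t) a]
  refine integral_congr_ae ?_
  filter_upwards [translation_coe a f] with t ht
  rw [ht, add_sub_cancel_right]

open scoped Convolution in
-- Moving the translation onto the test function gives the convolution of f with the reflected φ,
-- which is differentiable although f is only in L².
theorem hasDerivAt_integral_test_translation {φ : ℝ → ℝ} (hφ : ContDiff ℝ ∞ φ)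
    (hs : HasCompactSupport φ) (f : L2) (a : ℝ) :
    HasDerivAt (fun a => ∫ t, φ t • translation a f t) (-∫ t, deriv φ (t - a) • f t) a := by
  let M : ℂ →L[ℝ] ℝ →L[ℝ] ℂ := (ContinuousLinearMap.lsmul ℝ ℝ).flip
  let ρ : ℝ → ℝ := fun s => φ (-s)
  have hρ : ContDiff ℝ ∞ ρ := hφ.comp contDiff_neg
  have hρs : HasCompactSupport ρ := hs.comp_homeomorph (Homeomorph.neg ℝ)
  have h1 := hρs.hasDerivAt_convolution_right M
    ((Lp.memLp f).locallyIntegrable (μ := (volume : Measure ℝ)) (by norm_num))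
    (hρ.of_le (by simp)) a
  have h2 : ∀ x, ((f : ℝ → ℂ) ⋆[M, volume] ρ) x = ∫ t, φ t • translation x f t := fun x => by
    rw [integral_test_smul_translation, convolution_def]
    refine integral_congr_ae (Eventually.of_forall fun t => ?_)
    simp [M, ρ]
  have h3 : ((f : ℝ → ℂ) ⋆[M, volume] deriv ρ) a = -∫ t, deriv φ (t - a) • f t := by
    rw [← integral_neg, convolution_def]
    refine integral_congr_ae (Eventually.of_forall fun t => ?_)
    have : deriv ρ (a - t) = -deriv φ (t - a) := by
      rw [show ρ = fun s => φ (-s) from rfl, deriv_comp_neg, neg_sub]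
    simp [M, this]
  rw [← h3]
  exact h1.congr_of_eventuallyEq (Eventually.of_forall fun x => (h2 x).symm)

/-- Pair the difference quotients of the translations with φ: strong convergence gives ∫ φ g,
differentiation under the pairing gives −∫ φ' f. -/
theorem multiplierGraph_ddtSymbol_le : multiplierGraph (ddtSymbol 1) ≤ weakDerivGraph := by
  rintro ⟨f, g⟩ hfg φ hφ hs
  have h1 := (tendsto_multiplierSemigroup_slope_iff (measurable_ddtSymbol 1)
    (fun w => (ddtSymbol_re 1 w).le) f g).1 hfg
  set φL := (memLp_test hφ.continuous hs).toLp _ with hφL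
  have h2 : Tendsto (fun h : ℝ => inner ℂ φL (((h⁻¹ : ℝ) : ℂ) •
      (multiplierSemigroup (ddtSymbol 1) h f - f))) (𝓝[>] 0) (𝓝 (inner ℂ φL g)) :=
    ((innerSL ℂ φL).continuous.tendsto g).comp h1
  have h3 := (hasDerivAt_integral_test_translation hφ hs f 0).hasDerivWithinAt (s := Ioi 0)
  rw [hasDerivWithinAt_iff_tendsto_slope' self_notMem_Ioi] at h3
  have h4 := tendsto_nhds_unique_of_eventuallyEq h2 h3 (by
    filter_upwards [self_mem_nhdsWithin] with h hh
    rw [slope_def_module, multiplierSemigroup_ddtSymbol 1 (le_of_lt hh), one_mul, sub_zero,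
      integral_test_smul_eq_inner hφ.continuous hs, integral_test_smul_eq_inner hφ.continuous hs,
      translation_zero, inner_smul_right, inner_sub_right, Complex.real_smul]
    rfl)
  simp only [sub_zero] at h4
  rw [integral_test_smul_eq_inner hφ.continuous hs, h4, neg_neg]

/-- An `L²` function that equals its weak derivative vanishes. -/
theorem eq_zero_of_weakDeriv_self {d : L2} (hd : (d, d) ∈ weakDerivGraph) : d = 0 := by
  have h0 : ∀ φ : ℝ → ℝ, ContDiff ℝ ∞ φ → HasCompactSupport φ → ∫ t, φ t • d t = 0 := by
    intro φ hφ hs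
    -- Testing the hypothesis against φ(· − a) gives F' = F, so F(a) = e^a F(0); but F is bounded,
    -- hence F(0) = 0.
    let F : ℝ → ℂ := fun a => ∫ t, φ t • translation a d t
    have hF : ∀ a, HasDerivAt F (F a) a := fun a => by
      have h1 := hasDerivAt_integral_test_translation hφ hs d a
      have h2 := hd (fun t => φ (t - a)) (hφ.comp (contDiff_id.sub contDiff_const))
        (hs.comp_homeomorph (Homeomorph.subRight a))
      have h3 : deriv (fun t => φ (t - a)) = fun t => deriv φ (t - a) := by
        ext t; rw [deriv_comp_sub_const]
      simp only [h3] at h2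
      rw [h2, neg_neg, ← integral_test_smul_translation φ a d] at h1
      exact h1
    have hconst : ∀ a, Real.exp (-a) • F a = F 0 := fun a => by
      have h1 : ∀ a, HasDerivAt (fun a => Real.exp (-a) • F a) 0 a := fun a => by
        have h2 := ((hasDerivAt_neg a).exp).smul (hF a)
        refine h2.congr_deriv ?_
        simp
      have := is_const_of_deriv_eq_zero (fun a => (h1 a).differentiableAt)
        (fun a => (h1 a).deriv) a 0
      simpa using this
    have hbound : ∀ a, ‖F a‖ ≤ ‖(memLp_test hφ.continuous hs).toLp _‖ * ‖d‖ := fun a => by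
      simp only [F]
      rw [integral_test_smul_eq_inner hφ.continuous hs, ← norm_translation a d]
      exact norm_inner_le_norm _ _
    have hlim : Tendsto (fun a : ℝ => Real.exp (-a) *
        (‖(memLp_test hφ.continuous hs).toLp _‖ * ‖d‖)) atTop (𝓝 0) := by
      simpa using (Real.tendsto_exp_neg_atTop_nhds_zero).mul_const
        (‖(memLp_test hφ.continuous hs).toLp _‖ * ‖d‖)
    have h4 : ‖F 0‖ ≤ 0 := ge_of_tendsto' hlim fun a => by
      rw [← hconst a, norm_smul, Real.norm_eq_abs, Real.abs_exp]
      gcongr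
      exact hbound a
    have h5 := norm_le_zero_iff.1 h4
    simpa [F, translation_zero] using h5
  exact (Lp.eq_zero_iff_ae_eq_zero).2 (ae_eq_zero_of_integral_contDiff_smul_eq_zero
    ((Lp.memLp d).locallyIntegrable (by norm_num)) h0)

/-- The weak derivative is the Fourier multiplier with symbol `2πiw`. -/
theorem weakDerivGraph_eq : weakDerivGraph = multiplierGraph (ddtSymbol 1) := by
  refine le_antisymm ?_ multiplierGraph_ddtSymbol_le
  rintro ⟨f, g⟩ hfg
  have hne : ∀ w, 1 - ddtSymbol 1 w ≠ 0 := fun w h => by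
    have := congrArg Complex.re h
    simp [ddtSymbol_re] at this
  have hb : IsBoundedSymbol fun w => (1 - ddtSymbol 1 w)⁻¹ := by
    refine ⟨((measurable_ddtSymbol 1).const_sub 1).inv, 1, fun w => ?_⟩
    rw [norm_inv]
    refine inv_le_one_of_one_le₀ ?_
    have := Complex.abs_re_le_norm (1 - ddtSymbol 1 w)
    simpa [ddtSymbol_re] using this
  -- f₁ solves f₁ − ∂_t f₁ = f − g in the multiplier domain; then f − f₁ equals its own weak
  -- derivative and vanishes.
  set f₁ := fourierMul (fun w => (1 - ddtSymbol 1 w)⁻¹) (f - g) with hf₁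
  have h1 : (f₁, f₁ - (f - g)) ∈ multiplierGraph (ddtSymbol 1) := by
    change (𝓕 (f₁ - (f - g)) : L2) =ᵐ[volume] fun w => ddtSymbol 1 w * (𝓕 f₁ : L2) w
    filter_upwards [fourier_sub_coe f₁ (f - g), fourier_fourierMul hb (f - g)] with w h2 h3
    rw [h2, hf₁, h3]
    field_simp [hne w]
    ring
  have h2 := weakDerivGraph.sub_mem hfg (multiplierGraph_ddtSymbol_le h1)
  have h3 : (f, g) - (f₁, f₁ - (f - g)) = (f - f₁, f - f₁) := by
    rw [Prod.mk_sub_mk]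
    congr 1
    abel
  rw [h3] at h2
  have h4 := sub_eq_zero.1 (eq_zero_of_weakDeriv_self h2)
  rw [← h4] at h1
  simpa using h1

theorem smul_ddt_graph {c : ℝ} (hc : c ≠ 0) :
    ((c : ℂ) • ddt).graph = multiplierGraph (ddtSymbol c) := by
  have hc' : (c : ℂ) ≠ 0 := by exact_mod_cast hc
  ext ⟨f, g⟩
  have h1 : (f, g) ∈ ((c : ℂ) • ddt).graph ↔ (f, (c : ℂ)⁻¹ • g) ∈ ddt.graph := by
    rw [LinearPMap.smul_graph, Submodule.mem_map]
    constructor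
    · rintro ⟨⟨a, b⟩, hab, h⟩
      simp only [LinearMap.prodMap_apply, LinearMap.id_coe, id, LinearMap.smul_apply,
        Prod.mk_inj] at h
      rw [← h.1, ← h.2, inv_smul_smul₀ hc']
      exact hab
    · intro h
      exact ⟨(f, (c : ℂ)⁻¹ • g), h, Prod.ext rfl (smul_inv_smul₀ hc' g)⟩
  rw [h1, ddt_graph, weakDerivGraph_eq]
  have h2 : ∀ w, ddtSymbol c w = c * ddtSymbol 1 w := fun w => by
    simp only [ddtSymbol]; push_cast; ring
  change (𝓕 ((c : ℂ)⁻¹ • g) : L2) =ᵐ[volume] (fun w => ddtSymbol 1 w * (𝓕 f : L2) w) ↔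
    (𝓕 g : L2) =ᵐ[volume] fun w => ddtSymbol c w * (𝓕 f : L2) w
  constructor <;> intro h <;> filter_upwards [h, fourier_smul_coe (c : ℂ)⁻¹ g] with w h3 h4
  · rw [h4, inv_mul_eq_iff_eq_mul₀ hc'] at h3
    rw [h3, h2, mul_assoc]
  · rw [h4, h3, h2, mul_assoc, inv_mul_cancel_left₀ hc']

end WeakDerivative

/-! ### Smoothing for sectorial symbols -/

section AnalyticSemigroup

theorem pow_mul_exp_neg_le (k : ℕ) {s t : ℝ} (hs : 0 < s) (ht : 0 ≤ t) :
    t ^ k * Real.exp (-(s * t)) ≤ k.factorial / s ^ k := by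
  have h1 := Real.pow_div_factorial_le_exp (s * t) (by positivity) k
  rw [Real.exp_neg, ← div_eq_mul_inv, div_le_div_iff₀ (Real.exp_pos _) (by positivity)]
  rw [div_le_iff₀ (by positivity), mul_pow] at h1
  linarith

variable {m : ℝ → ℂ} {δ : ℝ}

/-- The Fourier multiplier `m^k exp (|z| m)`. -/
noncomputable def multiplierSemigroupDeriv (m : ℝ → ℂ) (k : ℕ) (z : ℝ) : L2 →L[ℂ] L2 :=
  fourierMul fun w => m w ^ k * Complex.exp ((|z| : ℝ) * m w)

theorem multiplierSemigroupDeriv_zero (m : ℝ → ℂ) (z : ℝ) :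
    multiplierSemigroupDeriv m 0 z = multiplierSemigroup m z := by
  simp [multiplierSemigroupDeriv, multiplierSemigroup]

/-- In the sector Re m ≤ −δ|m| the exponential decays like e^{−zδ|m|} and absorbs every power of
|m|, at the price of a constant singular at z = 0. -/
theorem isBoundedSymbol_pow_mul_exp (hm : Measurable m) (hδ : 0 < δ)
    (hsec : ∀ w, (m w).re ≤ -(δ * ‖m w‖)) (k : ℕ) {z : ℝ} (hz : 0 < z) :
    IsBoundedSymbol fun w => m w ^ k * Complex.exp ((|z| : ℝ) * m w) := by
  refine ⟨(hm.pow_const k).mul (Complex.measurable_exp.comp (measurable_const.mul hm)),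
    k.factorial / (z * δ) ^ k, fun w => ?_⟩
  rw [norm_mul, norm_pow, Complex.norm_exp, Complex.re_ofReal_mul, abs_of_pos hz]
  refine le_trans ?_ (pow_mul_exp_neg_le k (mul_pos hz hδ) (norm_nonneg (m w)))
  gcongr
  rw [mul_assoc, ← mul_neg]
  exact mul_le_mul_of_nonneg_left (hsec w) hz.le

theorem fourier_multiplierSemigroupDeriv (hm : Measurable m) (hδ : 0 < δ)
    (hsec : ∀ w, (m w).re ≤ -(δ * ‖m w‖)) (k : ℕ) {z : ℝ} (hz : 0 < z) (f : L2) :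
    (𝓕 (multiplierSemigroupDeriv m k z f) : L2) =ᵐ[volume]
      fun w => m w ^ k * Complex.exp ((|z| : ℝ) * m w) * (𝓕 f : L2) w :=
  fourier_fourierMul (isBoundedSymbol_pow_mul_exp hm hδ hsec k hz) f

theorem hasDerivAt_multiplierSemigroupDeriv (hm : Measurable m) (hδ : 0 < δ)
    (hsec : ∀ w, (m w).re ≤ -(δ * ‖m w‖)) (k : ℕ) {x : ℝ} (hx : 0 < x) (f : L2) :
    HasDerivAt (fun z => multiplierSemigroupDeriv m k z f)
      (multiplierSemigroupDeriv m (k + 1) x f) x := by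
  have hx2 : 0 < x / 2 := half_pos hx
  refine hasDerivAt_of_multiplier (f := f)
    (b := fun z w => m w ^ k * Complex.exp ((|z| : ℝ) * m w))
    -- For z > x/2 all exponentials decay at rate at least (x/2)δ|m|; the mean value inequality
    -- supplies the extra power of |m|.
    (C := (k + 1).factorial / (x / 2 * δ) ^ (k + 1)) ?_
    (fourier_multiplierSemigroupDeriv hm hδ hsec (k + 1) hx f) (fun w => ?_) ?_
  · filter_upwards [lt_mem_nhds hx] with z hz
    exact fourier_multiplierSemigroupDeriv hm hδ hsec k hz f
  · have h1 : HasDerivAt (fun z : ℝ => Complex.exp (z * m w)) (Complex.exp (x * m w) * m w) x := by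
      have := (((hasDerivAt_id x).ofReal_comp).mul_const (m w)).cexp
      simpa using this
    refine ((h1.const_mul (m w ^ k)).congr_of_eventuallyEq ?_).congr_deriv ?_
    · filter_upwards [lt_mem_nhds hx] with z hz
      rw [abs_of_pos hz]
    · rw [abs_of_pos hx, pow_succ]; ring
  · filter_upwards [lt_mem_nhds (half_lt_self hx)] with z hz w
    have hre : ∀ y : ℝ, x / 2 ≤ y → ((y : ℂ) * m w).re ≤ -(x / 2 * δ * ‖m w‖) := fun y hy => by
      have h0 : 0 ≤ δ * ‖m w‖ := by positivity
      rw [Complex.re_ofReal_mul]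
      calc y * (m w).re ≤ y * -(δ * ‖m w‖) :=
            mul_le_mul_of_nonneg_left (hsec w) (hx2.le.trans hy)
        _ ≤ -(x / 2 * δ * ‖m w‖) := by nlinarith
    rw [abs_of_pos (hx2.trans hz), abs_of_pos hx, ← mul_sub, norm_mul, norm_pow]
    have h1 := norm_exp_sub_exp_le (hre z hz.le) (hre x (half_le_self hx.le))
    rw [← sub_mul, norm_mul, ← Complex.ofReal_sub, Complex.norm_real, Real.norm_eq_abs] at h1
    calc ‖m w‖ ^ k * ‖Complex.exp (z * m w) - Complex.exp (x * m w)‖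
        ≤ ‖m w‖ ^ k * (Real.exp (-(x / 2 * δ * ‖m w‖)) * (|z - x| * ‖m w‖)) := by gcongr
      _ = ‖m w‖ ^ (k + 1) * Real.exp (-(x / 2 * δ * ‖m w‖)) * |z - x| := by ring
      _ ≤ _ := by
          gcongr
          exact pow_mul_exp_neg_le (k + 1) (mul_pos hx2 hδ) (norm_nonneg _)

end AnalyticSemigroup

/-! ### The square root and the heat equation in the x-direction -/

section HeatEquation

/-- The point is the domain: s ≤ 1 + s² with s the modulus of the symbol shows that the intermediate
function is in L² as soon as f and its image under the squared symbol are. -/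
theorem fracPow_half_comp {c : ℝ} (hc : c ≠ 0) (f k : L2) :
    (f, k) ∈ ((c : ℂ) • ddt).graph ↔
      ∃ g, (f, g) ∈ (fracPow c (1 / 2)).graph ∧ (g, k) ∈ (fracPow c (1 / 2)).graph := by
  rw [smul_ddt_graph hc, fracPow_graph]
  change (𝓕 k : L2) =ᵐ[volume] (fun w => ddtSymbol c w * (𝓕 f : L2) w) ↔
    ∃ g : L2, (𝓕 g : L2) =ᵐ[volume] (fun w => fracSymbol c (1 / 2) w * (𝓕 f : L2) w) ∧
      (𝓕 k : L2) =ᵐ[volume] fun w => fracSymbol c (1 / 2) w * (𝓕 g : L2) w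
  have hsq : ∀ w, ddtSymbol c w = fracSymbol c (1 / 2) w * fracSymbol c (1 / 2) w := fun w =>
    (fracSymbol_half_sq c w).symm
  constructor
  · intro h
    have hmem : MemLp (fun w => fracSymbol c (1 / 2) w * (𝓕 f : L2) w) 2 volume := by
      have h1 : MemLp (fun w => ‖(𝓕 f : L2) w‖ + ‖(𝓕 k : L2) w‖) 2 volume :=
        (Lp.memLp _).norm.add (Lp.memLp _).norm
      refine h1.mono' ((measurable_fracSymbol c _).aestronglyMeasurable.mul
        (Lp.aestronglyMeasurable _)) ?_
      filter_upwards [h] with w hw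
      rw [hw, hsq, norm_mul, norm_mul, norm_mul]
      set s := ‖fracSymbol c (1 / 2) w‖
      have h2 : s ≤ 1 + s * s := by nlinarith [sq_nonneg (s - 1)]
      calc s * ‖(𝓕 f : L2) w‖ ≤ (1 + s * s) * ‖(𝓕 f : L2) w‖ := by gcongr
        _ = _ := by ring
    have hg : (𝓕 (𝓕⁻ (hmem.toLp _) : L2) : L2) = hmem.toLp _ :=
      (Lp.fourierTransformₗᵢ ℝ ℂ).apply_symm_apply _
    refine ⟨𝓕⁻ (hmem.toLp _), ?_, ?_⟩
    · rw [hg]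
      exact hmem.coeFn_toLp
    · rw [hg]
      filter_upwards [h, hmem.coeFn_toLp] with w h1 h2
      rw [h1, h2, hsq, mul_assoc]
  · rintro ⟨g, hg, hk⟩
    filter_upwards [hg, hk] with w h1 h2
    rw [h2, h1, hsq, mul_assoc]

/-- The semigroup generated by `-(c ∂_t)^{1/2}` solves `∂_x² w = c ∂_t w`. -/
theorem heat_evolution {c : ℝ} (hc : 0 < c) (f : L2) {x : ℝ} (hx : 0 < x) :
    ∃ g k : L2,
      (multiplierSemigroup (fun w => -fracSymbol c (1 / 2) w) x f, g) ∈
        (fracPow c (1 / 2)).graph ∧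
      (multiplierSemigroup (fun w => -fracSymbol c (1 / 2) w) x f, k) ∈
        ((c : ℂ) • ddt).graph ∧
      HasDerivAt (fun z => multiplierSemigroup (fun w => -fracSymbol c (1 / 2) w) z f) (-g) x ∧
      HasDerivAt (deriv fun z => multiplierSemigroup (fun w => -fracSymbol c (1 / 2) w) z f) k x ∧
      HasDerivAt (fun z => multiplierSemigroup (fun w => -fracSymbol c (1 / 2) w) (-z) f) g (-x) ∧
      HasDerivAt (deriv fun z => multiplierSemigroup (fun w => -fracSymbol c (1 / 2) w) (-z) f) k
        (-x) := by
  set m : ℝ → ℂ := fun w => -fracSymbol c (1 / 2) w with hmdef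
  -- The symbol has argument ±π/4, so the sector condition holds with equality for δ = cos(π/4).
  set δ : ℝ := Real.cos (1 / 2 * (Real.pi / 2)) with hδdef
  have hm : Measurable m := (measurable_fracSymbol c _).neg
  have hδ : 0 < δ := Real.cos_pos_of_mem_Ioo ⟨by linarith [Real.pi_pos], by linarith [Real.pi_pos]⟩
  have hsec : ∀ w, (m w).re ≤ -(δ * ‖m w‖) := fun w => by
    rw [hmdef, Complex.neg_re, fracSymbol_re hc (by norm_num), norm_neg, mul_comm]
  have hre : ∀ w, (m w).re ≤ 0 := neg_fracSymbol_re_nonpos hc (by norm_num) (by norm_num)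
  have h0 := fourier_multiplierSemigroup hm hre x f
  have hd1 : ∀ z, 0 < z → HasDerivAt (fun z => multiplierSemigroup m z f)
      (multiplierSemigroupDeriv m 1 z f) z := fun z hz => by
    simpa only [multiplierSemigroupDeriv_zero] using
      hasDerivAt_multiplierSemigroupDeriv hm hδ hsec 0 hz f
  have hd2 : HasDerivAt (deriv fun z => multiplierSemigroup m z f)
      (multiplierSemigroupDeriv m 2 x f) x := by
    refine (hasDerivAt_multiplierSemigroupDeriv hm hδ hsec 1 hx f).congr_of_eventuallyEq ?_
    filter_upwards [lt_mem_nhds hx] with z hz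
    exact (hd1 z hz).deriv
  have hrefl : ∀ {F : ℝ → L2} {F' : L2}, HasDerivAt F F' x →
      HasDerivAt (fun z => F (-z)) (-F') (-x) := fun {F F'} h => by
    have h1 : HasDerivAt F F' (-(-x)) := by rwa [neg_neg]
    exact (h1.scomp (-x) (hasDerivAt_neg (-x))).congr_deriv (by simp)
  -- Here m is minus the symbol of R, so R w = −∂_x w; the sign drops out in m², the symbol of c∂_t.
  refine ⟨-multiplierSemigroupDeriv m 1 x f, multiplierSemigroupDeriv m 2 x f, ?_, ?_, ?_, hd2,
    hrefl (hd1 x hx), ?_⟩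
  · rw [fracPow_graph]
    change (𝓕 (-multiplierSemigroupDeriv m 1 x f) : L2) =ᵐ[volume]
      fun w => fracSymbol c (1 / 2) w * (𝓕 (multiplierSemigroup m x f) : L2) w
    rw [show (𝓕 (-multiplierSemigroupDeriv m 1 x f) : L2) = -𝓕 (multiplierSemigroupDeriv m 1 x f)
      from (Lp.fourierTransformₗᵢ ℝ ℂ).map_neg _]
    filter_upwards [h0, fourier_multiplierSemigroupDeriv hm hδ hsec 1 hx f,
      Lp.coeFn_neg (𝓕 (multiplierSemigroupDeriv m 1 x f) : L2)] with w h1 h2 h3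
    rw [h3, Pi.neg_apply, h2, h1, hmdef]
    ring
  · rw [smul_ddt_graph hc.ne']
    change (𝓕 (multiplierSemigroupDeriv m 2 x f) : L2) =ᵐ[volume]
      fun w => ddtSymbol c w * (𝓕 (multiplierSemigroup m x f) : L2) w
    filter_upwards [h0, fourier_multiplierSemigroupDeriv hm hδ hsec 2 hx f] with w h1 h2
    rw [h2, h1, show ddtSymbol c w = _ from (fracSymbol_half_sq c w).symm, hmdef]
    ring
  · rw [neg_neg]
    exact hd1 x hx
  · have h1 : (deriv fun z => multiplierSemigroup m (-z) f) =
        fun z => -deriv (fun z => multiplierSemigroup m z f) (-z) := by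
      ext1 z
      exact deriv_comp_neg (fun z => multiplierSemigroup m z f) z
    rw [h1]
    exact (hrefl hd2).neg.congr_deriv (neg_neg _)

end HeatEquation

end ColeHopf

/-! ### The main theorem -/

theorem mainTheorem9 :
    -- the logarithmic representation for a commuting invertible evolution family
    (∀ (X : Type*) [NormedAddCommGroup X] [NormedSpace ℂ X] [CompleteSpace X]
      (Y : Type*) [NormedAddCommGroup Y] [NormedSpace ℂ Y] [CompleteSpace Y]
      (L : ℝ) (J : Y →L[ℂ] X) (U : ℝ → ℝ → X →L[ℂ] X) (UY : ℝ → ℝ → Y →L[ℂ] Y)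
      (A : ℝ → Y →ₗ[ℂ] X), 0 < L →
      ColeHopf.IsEvolutionFamily L J U UY A → ColeHopf.Commutes L U UY A →
      (∃ (κ : ℂ) (r : ℝ), ColeHopf.IsLogContour L U UY κ r) ∧
      ∀ (κ : ℂ) (r : ℝ), ColeHopf.IsLogContour L U UY κ r →
        κ ≠ 0 ∧ ∀ x ∈ Icc 0 L, ∀ ξ ∈ Icc 0 L,
          spectrum ℂ (U x ξ + κ • (1 : X →L[ℂ] X)) ⊆ Metric.ball κ r ∧
          NormedSpace.exp (ColeHopf.logOp U κ r x ξ) = U x ξ + κ • (1 : X →L[ℂ] X) ∧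
          IsUnit (1 - κ • NormedSpace.exp (-ColeHopf.logOp U κ r x ξ)) ∧
          ∀ y : Y, ∃ g : X,
            -- `g` is the weak derivative of `Log (U(x, ξ) + κ I) y` in the first variable
            ColeHopf.HasWeakDerivWithinAt (fun z => ColeHopf.logOp U κ r z ξ (J y)) g
              (Icc 0 L) x ∧
            (∀ g' : X, ColeHopf.HasWeakDerivWithinAt
              (fun z => ColeHopf.logOp U κ r z ξ (J y)) g' (Icc 0 L) x → g' = g) ∧
            A x (UY x ξ y) = NormedSpace.exp (ColeHopf.logOp U κ r x ξ) g ∧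
            A x y =
              Ring.inverse (1 - κ • NormedSpace.exp (-ColeHopf.logOp U κ r x ξ)) g ∧
            A x y = g + κ • U ξ x g ∧
            -- the classical transform of every scalar component of the orbit
            ∀ μ : ℝ, 0 < μ → ∀ φ : X →L[ℂ] ℂ, φ (U x ξ (J y)) ≠ 0 →
              DifferentiableWithinAt ℝ (fun z => φ (U z ξ (J y))) (Icc 0 L) x ∧
              ColeHopf.coleHopf μ L (fun z => φ (U z ξ (J y))) x =
                ((-2 * (√μ)⁻¹ : ℝ) : ℂ) *
                  (φ (NormedSpace.exp (ColeHopf.logOp U κ r x ξ) g) *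
                    (φ (U x ξ (J y)))⁻¹)) ∧
    -- multiplication families in a commutative Banach algebra: the normalization is the
    -- classical transform
    (∀ (B : Type*) [NormedCommRing B] [NormedAlgebra ℂ B] [CompleteSpace B]
      (L : ℝ) (u u' : ℝ → B), 0 < L → (∀ x ∈ Icc 0 L, IsUnit (u x)) →
      (∀ x ∈ Icc 0 L, HasDerivWithinAt u (u' x) (Icc 0 L) x) →
      ∀ (U : ℝ → ℝ → B →L[ℂ] B) (A : ℝ → B →ₗ[ℂ] B),
      (∀ x ξ, U x ξ = ContinuousLinearMap.mul ℂ B (u x * Ring.inverse (u ξ))) →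
      (∀ x, A x = LinearMap.mulLeft ℂ (u' x * Ring.inverse (u x))) →
      ColeHopf.IsEvolutionFamily L (ContinuousLinearMap.id ℂ B) U U A ∧
      ColeHopf.Commutes L U U A ∧
      (∀ x ∈ Icc 0 L, ∀ ξ ∈ Icc 0 L, U x ξ (u ξ) = u x) ∧
      ∀ (κ : ℂ) (r : ℝ), ColeHopf.IsLogContour L U U κ r →
        ∀ x ∈ Icc 0 L, ∀ ξ ∈ Icc 0 L, ∀ v : B, ∃ g : B,
          ColeHopf.HasWeakDerivWithinAt (fun z => ColeHopf.logOp U κ r z ξ v) g (Icc 0 L) x ∧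
          ∀ μ : ℝ, 0 < μ →
            ((-2 * (√μ)⁻¹ : ℝ) : ℂ) • (u' x * Ring.inverse (u x)) * v =
              ((-2 * (√μ)⁻¹ : ℝ) : ℂ) •
                Ring.inverse (1 - κ • NormedSpace.exp (-ColeHopf.logOp U κ r x ξ)) g) ∧
    -- generation in `L²(-∞, ∞)` and evolution of the heat equation in the `x`-direction
    (∀ μ : ℝ, 0 < μ →
      -- `μ^{1/2} ∂_t` with domain `H¹` generates the group of translations
      (∃ V : ℝ → ColeHopf.L2 →L[ℂ] ColeHopf.L2,
        ColeHopf.IsC0Semigroup V ∧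
        ColeHopf.IsGenerator (((√μ : ℝ) : ℂ) • ColeHopf.ddt) V ∧
        (∀ s t : ℝ, V (s + t) = V s * V t) ∧
        (∀ f, Continuous fun h => V h f) ∧
        (∀ (h : ℝ) (f : ColeHopf.L2), ‖V h f‖ = ‖f‖) ∧
        ∀ (h : ℝ) (f : ColeHopf.L2), V h f =ᵐ[volume] fun t => f (t + √μ * h)) ∧
      -- the fractional powers generate contraction semigroups
      (∀ α : ℝ, 0 < α → α < 1 → ∃ W : ℝ → ColeHopf.L2 →L[ℂ] ColeHopf.L2,
        ColeHopf.IsC0Semigroup W ∧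
        ColeHopf.IsGenerator (-ColeHopf.fracPow (√μ) α) W ∧
        ∀ x, 0 ≤ x → ∀ f, ‖W x f‖ ≤ ‖f‖) ∧
      -- the power `1/2` is a square root of `μ^{1/2} ∂_t`, domains included
      (∀ f k : ColeHopf.L2, (f, k) ∈ (((√μ : ℝ) : ℂ) • ColeHopf.ddt).graph ↔
        ∃ g, (f, g) ∈ (ColeHopf.fracPow (√μ) (1 / 2)).graph ∧
          (g, k) ∈ (ColeHopf.fracPow (√μ) (1 / 2)).graph) ∧
      -- the semigroup `W` generated by `-(μ^{1/2} ∂_t)^{1/2}` solves `∂_x² w = μ^{1/2} ∂_t w` for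
      -- `x > 0`; its reflection, evolving by `+(μ^{1/2} ∂_t)^{1/2}`, solves it for `x < 0`
      ∃ W : ℝ → ColeHopf.L2 →L[ℂ] ColeHopf.L2,
        ColeHopf.IsC0Semigroup W ∧
        ColeHopf.IsGenerator (-ColeHopf.fracPow (√μ) (1 / 2)) W ∧
        ∀ f : ColeHopf.L2, ∀ x : ℝ, 0 < x →
          ∃ g k : ColeHopf.L2,
            (W x f, g) ∈ (ColeHopf.fracPow (√μ) (1 / 2)).graph ∧
            (W x f, k) ∈ (((√μ : ℝ) : ℂ) • ColeHopf.ddt).graph ∧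
            HasDerivAt (fun z => W z f) (-g) x ∧
            HasDerivAt (deriv fun z => W z f) k x ∧
            HasDerivAt (fun z => W (-z) f) g (-x) ∧
            HasDerivAt (deriv fun z => W (-z) f) k (-x)) := by
  refine ⟨fun X _ _ _ Y _ _ _ L J U UY A hL h hc => ⟨h.exists_isLogContour, fun κ r hκ => ?_⟩,
    fun B _ _ _ L u u' hL hu hd U A hU hA => ?_, fun μ hμ => ?_⟩
  · refine ⟨?_, fun x hx ξ hξ => h.logarithmic_representation hL hc hκ hx hξ⟩
    obtain ⟨hball, M, hM, hU⟩ := hκ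
    have h0 : (0 : ℝ) ∈ Icc 0 L := ⟨le_rfl, hL.le⟩
    exact norm_pos_iff.1 (((norm_nonneg _).trans (hU 0 h0 0 h0).1).trans_lt
      (hM.trans (ColeHopf.lt_norm_of_closedBall_subset_slitPlane hball)))
  · have h := ColeHopf.isEvolutionFamily_mul hu hd hU hA
    have hc : ColeHopf.Commutes L U U A := ColeHopf.commutes_mul hU hA
    refine ⟨h, hc, fun x _ ξ hξ => ?_, fun κ r hκ x hx ξ hξ v => ?_⟩
    · rw [hU, ContinuousLinearMap.mul_apply', mul_assoc, Ring.inverse_mul_cancel _ (hu ξ hξ),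
        mul_one]
    · obtain ⟨g, hg, -, -, hA', -⟩ := (h.logarithmic_representation hL hc hκ hx hξ).2.2.2 v
      refine ⟨g, hg, fun μ _ => ?_⟩
      rw [← hA', hA, LinearMap.mulLeft_apply, smul_mul_assoc]
  · have hc : 0 < √μ := Real.sqrt_pos.2 hμ
    refine ⟨⟨fun h => ColeHopf.translation (√μ * h), ?_, ?_, fun s t => ?_, fun f => ?_,
      fun h f => ColeHopf.norm_translation _ f, fun h f => ColeHopf.translation_coe _ f⟩,
      fun α hα hα1 => ⟨_, ColeHopf.isC0Semigroup_multiplierSemigroup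
        (ColeHopf.measurable_fracSymbol (√μ) α).neg (ColeHopf.neg_fracSymbol_re_nonpos hc hα hα1),
        ColeHopf.isGenerator_multiplierSemigroup (ColeHopf.measurable_fracSymbol (√μ) α).neg
          (ColeHopf.neg_fracSymbol_re_nonpos hc hα hα1) (ColeHopf.fracPow_neg_graph _ _),
        fun x _ f => ColeHopf.norm_multiplierSemigroup_le
          (ColeHopf.measurable_fracSymbol (√μ) α).neg
          (ColeHopf.neg_fracSymbol_re_nonpos hc hα hα1) x f⟩,
      ColeHopf.fracPow_half_comp hc.ne',
      ⟨_, ColeHopf.isC0Semigroup_multiplierSemigroup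
        (ColeHopf.measurable_fracSymbol (√μ) (1 / 2)).neg
        (ColeHopf.neg_fracSymbol_re_nonpos hc (by norm_num) (by norm_num)),
        ColeHopf.isGenerator_multiplierSemigroup
          (ColeHopf.measurable_fracSymbol (√μ) (1 / 2)).neg
          (ColeHopf.neg_fracSymbol_re_nonpos hc (by norm_num) (by norm_num))
          (ColeHopf.fracPow_neg_graph _ _),
        fun f x hx => ColeHopf.heat_evolution hc f hx⟩⟩
    · refine ⟨by rw [mul_zero, ColeHopf.translation_zero], fun s t _ _ => ?_, fun f => ?_⟩
      · rw [mul_add, ColeHopf.translation_add]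
      · exact ((ColeHopf.continuous_translation f).comp
          (continuous_const.mul continuous_id)).continuousOn
    · intro f g
      -- The generator sees only h > 0, where the translation group coincides with the multiplier
      -- semigroup.
      rw [ColeHopf.smul_ddt_graph hc.ne', ColeHopf.tendsto_multiplierSemigroup_slope_iff
        (ColeHopf.measurable_ddtSymbol _) (fun w => (ColeHopf.ddtSymbol_re _ w).le)]
      refine tendsto_congr' ?_
      filter_upwards [self_mem_nhdsWithin] with h hh
      rw [ColeHopf.multiplierSemigroup_ddtSymbol _ (le_of_lt hh)]
    · simp only [mul_add, ColeHopf.translation_add]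
    · exact (ColeHopf.continuous_translation f).comp (continuous_const.mul continuous_id)
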